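/- Let $1\le l\le k$ be integers and $d=k+l$, and let $\Delta(k,d)\subset\mathbb R^2$ be the closed triangle with vertices $(0,0)$, $(1,1)$ and $\bigl(\tfrac{d}{2d-k},\tfrac{d-k}{2d-k}\bigr)$. Let $\mathcal T(k,d)=\Delta(k,d)$ if $k(k+3)\ge 2d$, and let $\mathcal T(k,d)$ be the set of $(x,y)\in\Delta(k,d)$ with $x-y\le\frac{2k}{6d-k^2-5k}$ if $k(k+3)<2d$. Let $G\subset\mathbb R^k$ be nonempty and open, let $\Phi_1,\dots,\Phi_l$ be homogeneous polynomials on $\mathbb R^k$, let $S=\{(y;\Phi_1(y),\dots,\Phi_l(y)):y\in G\}\subset\mathbb R^d$, and let $\mu$ be the measure on $S$ induced by Lebesgue measure on $G$, i.e. its image under $y\mapsto(y;\Phi_1(y),\dots,\Phi_l(y))$. For $p,q\in[1,\infty]$ consider the estimate $$\|\mu*f\|_{L^q(\mathbb R^d)}\le C\,\|f\|_{L^p(\mathbb R^d)}\quad\text{for all } f\in L^p(\mathbb R^d),\qquad(1)$$ where $\mu*f(z)=\int f(z-x)\,d\mu(x)$ and $C<\infty$ does not depend on $f$ (it being part of (1)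 that this integral converges absolutely for almost every $z$ and that $\mu*f$ is measurable). Call $S$ a model surface if (1) holds, with some $C$ depending on $p,q$, whenever $(1/p,1/q)$ lies in the interior of $\mathcal T(k,d)$. **Theorem.** Let $\mathcal C=[c_i^j]$ be a real $k\times l$ matrix such that (*) every $l\times l$ submatrix of $\mathcal C$ is nonsingular. Put $\Phi_j(y)=\sum_{i=1}^k c_i^j y_i^2$ for $1\le j\le l$ and $G=\{y\in\mathbb R^k:|y|<1\}$. Then $S$ is a model surface. Explicitly, (1) holds whenever $(1/p,1/q)$ lies in the interior of $\Delta(k,d)$. This is optimal up to the boundary of the triangle: if (1) holds for some $p,q\in[1,\infty]$, then $(1/p,1/q)\in\Delta(k,d)$. Moreover, for all $1\le l\le k$ matrices satisfying (*) exist, so there are such surfaces whenever $d/2\le k<d$. -/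

import Mathlib

open MeasureTheory
open scoped ENNReal NNReal

namespace ModelSurface

/-- `ℝ^d` with `d = k + l`, written as `ℝ^k × ℝ^l`. Its `volume` is the product of the two Lebesgue
measures, that is, `d`-dimensional Lebesgue measure. Only this measure and the additive structure
are used on it. -/
abbrev Space (k l : ℕ) : Type := EuclideanSpace ℝ (Fin k) × EuclideanSpace ℝ (Fin l)

/-- The convolution `(μ ∗ f)(z) = ∫ f (z - x) dμ(x)` of a measure and a function. -/
noncomputable def measureConv {k l : ℕ} (μ : Measure (Space k l)) (f : Space k l → ℂ)
    (z : Space k l) : ℂ :=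
  ∫ x, f (z - x) ∂μ

/-- The convolution estimate `‖μ ∗ f‖_q ≤ C ‖f‖_p` for all `f ∈ L^p(ℝ^d)`, with `C` independent
of `f`. It includes that the integral defining `μ ∗ f` converges absolutely almost everywhere and
that `μ ∗ f` is (almost everywhere strongly) measurable. -/
def ConvolutionEstimate {k l : ℕ} (μ : Measure (Space k l)) (p q : ℝ≥0∞) : Prop :=
  ∃ C : ℝ≥0, ∀ f : Space k l → ℂ, MemLp f p volume →
    (∀ᵐ z ∂(volume : Measure (Space k l)), Integrable (fun x => f (z - x)) μ) ∧
    AEStronglyMeasurable (measureConv μ f) volume ∧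
    eLpNorm (measureConv μ f) q volume ≤ (C : ℝ≥0∞) * eLpNorm f p volume

/-- The point `(1/p, 1/q)`, with `1/∞ = 0`. -/
noncomputable def expPoint (p q : ℝ≥0∞) : ℝ × ℝ := ((p⁻¹).toReal, (q⁻¹).toReal)

/-- The closed triangle `Δ(k,d)`. -/
def triangle (k d : ℕ) : Set (ℝ × ℝ) :=
  convexHull ℝ {((0 : ℝ), (0 : ℝ)), ((1 : ℝ), (1 : ℝ)),
    ((d : ℝ) / (2 * (d : ℝ) - (k : ℝ)), ((d : ℝ) - (k : ℝ)) / (2 * (d : ℝ) - (k : ℝ)))}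

/-- The set `T(k,d)`: the whole triangle if `k (k + 3) ≥ 2 d`, and otherwise the part of the
triangle where `1/p - 1/q ≤ 2 k / (6 d - k ^ 2 - 5 k)`. -/
def typeSet (k d : ℕ) : Set (ℝ × ℝ) :=
  {x | x ∈ triangle k d ∧ (k * (k + 3) < 2 * d →
    x.1 - x.2 ≤ 2 * (k : ℝ) / (6 * (d : ℝ) - (k : ℝ) ^ 2 - 5 * (k : ℝ)))}

/-- The parametrization `y ↦ (y; Φ_1(y), …, Φ_l(y))`. -/
noncomputable def graphMap {k l : ℕ} (Φ : Fin l → MvPolynomial (Fin k) ℝ)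
    (y : EuclideanSpace ℝ (Fin k)) : Space k l :=
  (y, WithLp.toLp 2 fun j => MvPolynomial.eval (fun i => y i) (Φ j))

theorem continuous_graphMap {k l : ℕ} (Φ : Fin l → MvPolynomial (Fin k) ℝ) :
    Continuous (graphMap Φ) := by
  refine continuous_id.prodMk ((PiLp.continuous_toLp 2 _).comp (continuous_pi fun j => ?_))
  exact (MvPolynomial.continuous_eval (Φ j)).comp
    (continuous_pi fun i => (EuclideanSpace.proj (𝕜 := ℝ) i).continuous)

/-- The surface `S = {(y; Φ_1(y), …, Φ_l(y)) : y ∈ G}`. -/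
def surface {k l : ℕ} (G : Set (EuclideanSpace ℝ (Fin k)))
    (Φ : Fin l → MvPolynomial (Fin k) ℝ) : Set (Space k l) :=
  graphMap Φ '' G

/-- The measure on the surface induced by Lebesgue measure on `G` (regarded as a measure on
`ℝ^d`): the image of Lebesgue measure on `G` under the (continuous) parametrization. -/
noncomputable def surfaceMeasure {k l : ℕ} (G : Set (EuclideanSpace ℝ (Fin k)))
    (Φ : Fin l → MvPolynomial (Fin k) ℝ) : Measure (Space k l) :=
  (volume.restrict G).map (graphMap Φ)

/-- `S` is a model surface: it is the graph of homogeneous polynomials over a nonempty open set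
`G`, and its induced measure satisfies the `L^p → L^q` convolution estimate whenever `(1/p, 1/q)`
is interior to `T(k, k + l)`. (Being a graph, `S` determines `G` and the functions `Φ_j` on `G`,
hence also the induced measure.) -/
def IsModelSurface {k l : ℕ} (S : Set (Space k l)) : Prop :=
  ∃ (G : Set (EuclideanSpace ℝ (Fin k))) (Φ : Fin l → MvPolynomial (Fin k) ℝ),
    IsOpen G ∧ G.Nonempty ∧ (∀ j, ∃ n, (Φ j).IsHomogeneous n) ∧ S = surface G Φ ∧
    ∀ p q : ℝ≥0∞, expPoint p q ∈ interior (typeSet k (k + l)) →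
      ConvolutionEstimate (surfaceMeasure G Φ) p q

/-- Condition (*): every `l × l` submatrix of the `k × l` matrix `c` is nonsingular. -/
def ConditionStar {k l : ℕ} (c : Matrix (Fin k) (Fin l) ℝ) : Prop :=
  ∀ r : Fin l ↪ Fin k, (c.submatrix r id).det ≠ 0

/-- The quadratic forms `Φ_j(y) = ∑ i, c_i^j y_i ^ 2`. -/
noncomputable def quadForm {k l : ℕ} (c : Matrix (Fin k) (Fin l) ℝ) (j : Fin l) :
    MvPolynomial (Fin k) ℝ :=
  ∑ i, MvPolynomial.C (c i j) * MvPolynomial.X i ^ 2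

end ModelSurface

/-!
Write `μ` for the measure on the surface, `|E|` for Lebesgue measure and
`m(E, F) = ∫_F μ {u | z - u ∈ E} dz` (`convMass`) for the pairing of `μ ∗ 1_E` with `1_F`.

Sufficiency. Everything rests on bounds `m(E, F) ≤ C |E|^α |F|^β` (`RestrictedType`). They are
trivial for `(α, β) = (0, 1)` and `(1, 0)`, which are the vertices `(0, 0)` and `(1, 1)` of the
triangle under `(1/p, 1/q) = (α, 1 - β)`, and taking geometric means shows that the admissible
exponents form a convex set. So it suffices to reach points `(θ, θ)` with `θ` arbitrarily close to
`(k + l) / (k + 2 l)` (`restrictedType_surfaceMeasure`). As `m` is monotone in `μ`, the indicator of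
the unit ball may be replaced by the weight `exp (-‖y‖²)`. The Fourier transform of the resulting
measure is a product of Gaussian integrals with complex parameters, and at vertical frequency `η` it
is at most a constant times `∏ i, (1 + (c η)_i²)^(-1/4)` (`norm_gaussTransform_le`). Split the
frequencies by a smooth cutoff `χ(η)` at `∏ i, (1 + (c η)_i²) ≈ R²`. The high part maps `L²` to `L²`
with norm `O(R^(-1/2))`. The low part is a function bounded by the volume of the region
`∏ i, (1 + (c η)_i²) ≤ 2 R²`, which is `O(R^s)` for every `s > l / k`: by Hölder's inequality over
the cyclic intervals of `l` rows, `∏ i, (1 + (c η)_i²)^(-s/2)` is integrable, because each such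
interval of rows is an invertible matrix (`lintegral_decayWeight_rpow_lt_top`). Together
(`convMass_le_of_fourier`) this gives
`m(E, F) ≤ C (R^s |E| |F| + R^(-1/2) (|E| |F|)^(1/2))`, and `R` is chosen to balance the two terms.

Since the restricted estimates hold on an open set of exponents, the strong estimate follows by
summing over the level sets of `f` and then over those of `μ ∗ f`
(`exists_lintegral_conv_rpow_le`); two weak-type bounds with exponents on either side of the target
make these sums converge, so no duality or interpolation theorem is needed.

Necessity. The three sides of the triangle come from testing on the indicator functions of large
balls, of small balls, and of thin neighbourhoods of `-S`. Existence of the matrices is the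
nonvanishing of Vandermonde determinants.
-/

namespace ModelSurface

/-! ### A Fourier transform estimate for the mass of translates -/

section Fourier

open scoped SchwartzMap FourierTransform RealInnerProductSpace Topology

variable {V : Type*} [NormedAddCommGroup V] [InnerProductSpace ℝ V] [FiniteDimensional ℝ V]
  [MeasurableSpace V] [BorelSpace V]

theorem fourier_compSubConst (f : 𝓢(V, ℂ)) (u ζ : V) :
    𝓕 (f.compSubConstCLM ℂ u) ζ = Real.fourierChar (-⟪u, ζ⟫) • 𝓕 f ζ := by
  have h := congrFun (VectorFourier.fourierIntegral_comp_add_right Real.fourierChar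
    (volume : Measure V) (innerₗ V) (f : V → ℂ) (-u)) ζ
  simp only [map_neg, LinearMap.neg_apply, innerₗ_apply_apply] at h
  have hf : (f.compSubConstCLM ℂ u : V → ℂ) = f ∘ fun v => v + -u := by
    ext v; simp [sub_eq_add_neg]
  rw [SchwartzMap.fourier_coe, SchwartzMap.fourier_coe, hf]
  exact h

/-- The sesquilinear form `∫ a(u) ⟨g, τ_u f⟩ dP(u)` has as its multiplier the Fourier transform of
the complex measure `a P`. -/
theorem integral_mul_inner_translate (P : Measure V) [SFinite P] {a : V → ℂ} (ha : Integrable a P)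
    (f g : 𝓢(V, ℂ)) :
    ∫ u, a u * (∫ p, inner ℂ (g p) (f (p - u))) ∂P =
      ∫ ζ, inner ℂ (𝓕 g ζ) (𝓕 f ζ) * ∫ u, Real.fourierChar (-⟪u, ζ⟫) • a u ∂P := by
  have h1 : ∀ u, ∫ p, inner ℂ (g p) (f (p - u)) =
      ∫ ζ, inner ℂ (𝓕 g ζ) (𝓕 f ζ) * (Real.fourierChar (-⟪u, ζ⟫) : ℂ) := fun u => by
    have := SchwartzMap.integral_inner_fourier_fourier g (f.compSubConstCLM ℂ u)
    simp only [fourier_compSubConst, SchwartzMap.compSubConstCLM_apply] at this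
    rw [← this]
    refine integral_congr_ae (Filter.Eventually.of_forall fun ζ => ?_)
    simp only [Circle.smul_def, smul_eq_mul, RCLike.inner_apply]
    ring
  have hint : Integrable (fun ζ => inner ℂ (𝓕 g ζ) (𝓕 f ζ)) (volume : Measure V) := by
    have := (SchwartzMap.memLp (𝓕 f) 2 (μ := volume)).integrable_mul
      ((SchwartzMap.memLp (𝓕 g) 2 (μ := volume)).star)
    refine this.congr (Filter.Eventually.of_forall fun ζ => ?_)
    simp [RCLike.inner_apply]
  have hL : ∀ u, a u * ∫ p, inner ℂ (g p) (f (p - u)) =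
      ∫ ζ, a u * (inner ℂ (𝓕 g ζ) (𝓕 f ζ) * (Real.fourierChar (-⟪u, ζ⟫) : ℂ)) := fun u => by
    rw [h1, integral_const_mul]
  have hR : ∀ ζ, inner ℂ (𝓕 g ζ) (𝓕 f ζ) * ∫ u, Real.fourierChar (-⟪u, ζ⟫) • a u ∂P =
      ∫ u, a u * (inner ℂ (𝓕 g ζ) (𝓕 f ζ) * (Real.fourierChar (-⟪u, ζ⟫) : ℂ)) ∂P := fun ζ => by
    rw [← integral_const_mul]
    refine integral_congr_ae (Filter.Eventually.of_forall fun u => ?_)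
    simp only [Circle.smul_def, smul_eq_mul]
    ring
  simp_rw [hL, hR]
  refine integral_integral_swap ?_
  · have := (ha.mul_prod hint).bdd_mul (c := 1)
      (f := fun p : V × V => (Real.fourierChar (-⟪p.1, p.2⟫) : ℂ)) ?_ ?_
    · refine this.congr (Filter.Eventually.of_forall fun p => ?_)
      simp only [Function.uncurry]
      ring
    · refine Continuous.aestronglyMeasurable ?_
      exact continuous_subtype_val.comp (Real.continuous_fourierChar.comp (by fun_prop))
    · exact Filter.Eventually.of_forall fun p => (Circle.norm_coe _).le

/-- If the Fourier transforms of `a P` and `b Q` differ by at most `δ`, convolution with the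
difference has norm at most `δ` on `L²`. -/
theorem norm_integral_sub_integral_le (P Q : Measure V) [SFinite P] [SFinite Q] {a b : V → ℂ}
    (ha : Integrable a P) (hb : Integrable b Q) {δ : ℝ}
    (hδ : ∀ ζ, ‖(∫ u, Real.fourierChar (-⟪u, ζ⟫) • a u ∂P) -
      ∫ u, Real.fourierChar (-⟪u, ζ⟫) • b u ∂Q‖ ≤ δ) (f g : 𝓢(V, ℂ)) :
    ‖(∫ u, a u * (∫ p, inner ℂ (g p) (f (p - u))) ∂P) -
      ∫ u, b u * (∫ p, inner ℂ (g p) (f (p - u))) ∂Q‖ ≤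
      δ * (√(∫ x, ‖g x‖ ^ 2) * √(∫ x, ‖f x‖ ^ 2)) := by
  have hint : Integrable (fun ζ => inner ℂ (𝓕 g ζ) (𝓕 f ζ)) (volume : Measure V) := by
    have := (SchwartzMap.memLp (𝓕 f) 2 (μ := volume)).integrable_mul
      ((SchwartzMap.memLp (𝓕 g) 2 (μ := volume)).star)
    refine this.congr (Filter.Eventually.of_forall fun ζ => ?_)
    simp [RCLike.inner_apply]
  have key : ∀ (P : Measure V) [SFinite P] {a : V → ℂ}, Integrable a P →
      Integrable (fun ζ => inner ℂ (𝓕 g ζ) (𝓕 f ζ) *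
        ∫ u, Real.fourierChar (-⟪u, ζ⟫) • a u ∂P) (volume : Measure V) := by
    intro P _ a ha
    have hc : Continuous fun ζ => ∫ u, Real.fourierChar (-⟪u, ζ⟫) • a u ∂P :=
      VectorFourier.fourierIntegral_continuous (L := innerₗ V) Real.continuous_fourierChar
        continuous_inner ha
    refine hint.mul_bdd (c := ∫ u, ‖a u‖ ∂P) hc.aestronglyMeasurable ?_
    refine Filter.Eventually.of_forall fun ζ => (norm_integral_le_integral_norm _).trans ?_
    simp
  rw [integral_mul_inner_translate P ha, integral_mul_inner_translate Q hb,
    ← integral_sub (key P ha) (key Q hb)]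
  have hδ0 : 0 ≤ δ := (norm_nonneg _).trans (hδ 0)
  have h2 : ∀ h : 𝓢(V, ℂ), MemLp (fun x => ‖h x‖) (ENNReal.ofReal 2) (volume : Measure V) :=
    fun h => by simpa using (SchwartzMap.memLp h 2 (μ := volume)).norm
  have hmul : Integrable (fun ζ => ‖𝓕 g ζ‖ * ‖𝓕 f ζ‖) (volume : Measure V) := by
    have := (SchwartzMap.memLp (𝓕 g) 2 (μ := volume)).norm.integrable_mul
      ((SchwartzMap.memLp (𝓕 f) 2 (μ := volume)).norm)
    exact this
  calc _ ≤ ∫ ζ, δ * (‖𝓕 g ζ‖ * ‖𝓕 f ζ‖) := by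
        refine norm_integral_le_of_norm_le (hmul.const_mul δ)
          (Filter.Eventually.of_forall fun ζ => ?_)
        rw [← mul_sub, norm_mul, mul_comm]
        exact mul_le_mul (hδ ζ) (norm_inner_le_norm _ _) (norm_nonneg _) hδ0
    _ ≤ _ := by
        rw [integral_const_mul]
        refine mul_le_mul_of_nonneg_left ?_ hδ0
        have := integral_mul_le_Lp_mul_Lq_of_nonneg (μ := (volume : Measure V))
          Real.HolderConjugate.two_two
          (Filter.Eventually.of_forall fun ζ => norm_nonneg (𝓕 g ζ))
          (Filter.Eventually.of_forall fun ζ => norm_nonneg (𝓕 f ζ)) (h2 _) (h2 _)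
        simpa only [Real.rpow_ofNat, ← Real.sqrt_eq_rpow,
          SchwartzMap.integral_norm_sq_fourier] using this

/-- Smooth upper approximation of the indicator function of a compact set. -/
theorem exists_schwartz_of_isCompact {K : Set V} (hK : IsCompact K) {ε : ℝ} (hε : 0 < ε) :
    ∃ (f : 𝓢(V, ℂ)) (r : V → ℝ), (∀ x, f x = r x) ∧ (∀ x, 0 ≤ r x) ∧ (∀ x, r x ≤ 1) ∧
      (∀ x ∈ K, r x = 1) ∧
      (∫ x, ‖f x‖ ≤ volume.real K + ε) ∧ ∫ x, ‖f x‖ ^ 2 ≤ volume.real K + ε := by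
  obtain ⟨U, hKU, hUo, hU⟩ := K.exists_isOpen_lt_add (μ := (volume : Measure V))
    hK.measure_lt_top.ne (ε := ENNReal.ofReal ε) (by simpa using hε)
  obtain ⟨R, hR⟩ := hK.isBounded.subset_ball (0 : V)
  set W := U ∩ Metric.ball (0 : V) R
  have hKW : K ⊆ W := Set.subset_inter hKU hR
  have hWo : IsOpen W := hUo.inter Metric.isOpen_ball
  obtain ⟨r, h0, h1, h01⟩ := exists_contMDiffMap_zero_one_of_isClosed (n := (⊤ : ℕ∞))
    (modelWithCornersSelf ℝ V) hWo.isClosed_compl hK.isClosed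
    (Set.disjoint_left.2 fun x hx hxK => hx (hKW hxK))
  have hsm : ContDiff ℝ (⊤ : ℕ∞) (fun x => ((r x : ℝ) : ℂ)) :=
    Complex.ofRealCLM.contDiff.comp (contMDiff_iff_contDiff.1 r.contMDiff)
  have hcs : HasCompactSupport (fun x => ((r x : ℝ) : ℂ)) := by
    refine HasCompactSupport.of_support_subset_isCompact (isCompact_closedBall (0 : V) R) ?_
    intro x hx
    by_contra hxR
    refine hx ?_
    have : r x = 0 := h0 (fun hxW => hxR (Metric.ball_subset_closedBall hxW.2))
    simp [this]
  have hWfin : volume W < ∞ :=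
    Metric.isBounded_ball.measure_lt_top.trans_le' (measure_mono Set.inter_subset_right)
  have hWle : volume.real W ≤ volume.real K + ε := by
    rw [measureReal_def, measureReal_def]
    refine ENNReal.toReal_le_of_le_ofReal (by positivity) ?_
    rw [ENNReal.ofReal_add (by positivity) hε.le, ENNReal.ofReal_toReal hK.measure_lt_top.ne]
    exact (measure_mono Set.inter_subset_left).trans hU.le
  have hi : Integrable (W.indicator (fun _ => (1 : ℝ))) (volume : Measure V) :=
    (integrable_indicator_iff hWo.measurableSet).2 (integrableOn_const hWfin.ne)
  have hle : ∀ x, |r x| ≤ W.indicator (fun _ => (1 : ℝ)) x := fun x => by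
    by_cases hx : x ∈ W
    · simpa [hx, abs_of_nonneg (h01 x).1] using (h01 x).2
    · have : r x = 0 := h0 hx
      simp [this, hx]
  have hI : ∫ x, W.indicator (fun _ => (1 : ℝ)) x = volume.real W := by
    rw [integral_indicator hWo.measurableSet]; simp
  refine ⟨hcs.toSchwartzMap hsm, r, fun x => rfl, fun x => (h01 x).1, fun x => (h01 x).2,
    fun x hx => h1 hx, ?_, ?_⟩
  · refine (integral_mono_of_nonneg (Filter.Eventually.of_forall fun x => norm_nonneg _) hi
      (Filter.Eventually.of_forall fun x => ?_)).trans (hI.trans_le hWle)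
    simpa using hle x
  · refine (integral_mono_of_nonneg (Filter.Eventually.of_forall fun x => sq_nonneg _) hi
      (Filter.Eventually.of_forall fun x => ?_)).trans (hI.trans_le hWle)
    have := hle x
    simp only [HasCompactSupport.toSchwartzMap_toFun, Complex.norm_real, Real.norm_eq_abs]
    rw [abs_of_nonneg (h01 x).1] at *
    nlinarith [(h01 x).1, (h01 x).2]

end Fourier

/-! ### The mass of a pair of sets -/

section Pairing

variable {V : Type*} [AddCommGroup V] [MeasureSpace V] [MeasurableSub₂ V]

/-- The mass `∫_F μ {u | z - u ∈ E} dz`, which is the integral over `F` of the convolution of `μ`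
with the indicator function of `E`. -/
noncomputable def convMass (μ : Measure V) (E F : Set V) : ℝ≥0∞ :=
  ((volume : Measure V).prod μ) {p | p.1 - p.2 ∈ E ∧ p.1 ∈ F}

theorem measurableSet_convMass {E F : Set V} (hE : MeasurableSet E) (hF : MeasurableSet F) :
    MeasurableSet {p : V × V | p.1 - p.2 ∈ E ∧ p.1 ∈ F} :=
  (measurable_sub hE).inter (measurable_fst hF)

theorem convMass_eq_lintegral_left [SFinite (volume : Measure V)] (μ : Measure V) [SFinite μ]
    {E F : Set V} (hE : MeasurableSet E) (hF : MeasurableSet F) :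
    convMass μ E F = ∫⁻ u, volume {p | p - u ∈ E ∧ p ∈ F} ∂μ :=
  Measure.prod_apply_symm (measurableSet_convMass hE hF)

theorem convMass_eq_lintegral_right (μ : Measure V) [SFinite μ]
    {E F : Set V} (hE : MeasurableSet E) (hF : MeasurableSet F) :
    convMass μ E F = ∫⁻ z in F, μ {u | z - u ∈ E} := by
  rw [convMass, Measure.prod_apply (measurableSet_convMass hE hF), ← lintegral_indicator hF]
  refine lintegral_congr fun z => ?_
  by_cases hz : z ∈ F <;> simp [hz]

/-- As a function of the first set, the mass is a measure. -/
theorem convMass_eq_map_left (μ : Measure V) [SFinite μ] {E F : Set V} (hE : MeasurableSet E)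
    (hF : MeasurableSet F) : convMass μ E F =
      ((((volume : Measure V).restrict F).prod μ).map fun p => p.1 - p.2) E := by
  rw [convMass_eq_lintegral_right μ hE hF, Measure.map_apply (by fun_prop) hE,
    Measure.prod_apply (measurable_sub hE)]
  rfl

/-- The trivial estimate at the vertex `(0, 0)` of the triangle. -/
theorem convMass_le_right (μ : Measure V) [SFinite μ]
    {E F : Set V} (hE : MeasurableSet E) (hF : MeasurableSet F) :
    convMass μ E F ≤ μ Set.univ * volume F := by
  rw [convMass_eq_lintegral_right μ hE hF, ← setLIntegral_const]
  exact lintegral_mono fun z => measure_mono (Set.subset_univ _)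

/-- The trivial estimate at the vertex `(1, 1)` of the triangle. -/
theorem convMass_le_left [MeasurableAdd V] [SFinite (volume : Measure V)]
    [(volume : Measure V).IsAddRightInvariant]
    (μ : Measure V) [SFinite μ]
    {E F : Set V} (hE : MeasurableSet E) (hF : MeasurableSet F) :
    convMass μ E F ≤ μ Set.univ * volume E := by
  rw [convMass_eq_lintegral_left μ hE hF, mul_comm, ← lintegral_const]
  refine lintegral_mono fun u => (measure_mono fun p hp => hp.1).trans ?_
  exact ((measurePreserving_sub_right volume u).measure_preimage hE.nullMeasurableSet).le

end Pairing

section Bound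

open scoped SchwartzMap FourierTransform RealInnerProductSpace Topology

variable {V : Type*} [NormedAddCommGroup V] [InnerProductSpace ℝ V] [FiniteDimensional ℝ V]
  [MeasurableSpace V] [BorelSpace V]

/-- It suffices to bound the mass of pairs of compact sets. -/
theorem convMass_le_of_isCompact (μ : Measure V) [IsFiniteMeasure μ] {E F : Set V}
    (hE : MeasurableSet E) (hF : MeasurableSet F) (hFv : volume F ≠ ∞)
    {c : ℝ≥0∞} (h : ∀ K ⊆ E, ∀ L ⊆ F, IsCompact K → IsCompact L → convMass μ K L ≤ c) :
    convMass μ E F ≤ c := by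
  refine le_of_forall_lt fun r hr => ?_
  have : IsFiniteMeasure ((volume : Measure V).restrict F) := ⟨by simpa using hFv.lt_top⟩
  rw [convMass_eq_map_left μ hE hF] at hr
  obtain ⟨K, hKE, hK, hrK⟩ := hE.exists_lt_isCompact hr
  rw [← convMass_eq_map_left μ hK.measurableSet hF] at hrK
  set S := (fun p : V × V => p.1 - p.2) ⁻¹' K
  have hS : MeasurableSet S := measurable_sub hK.measurableSet
  have hmap : ∀ L, MeasurableSet L → convMass μ K L =
      ((((volume : Measure V).prod μ).restrict S).map Prod.fst) L := fun L hL => by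
    rw [Measure.map_apply measurable_fst hL, Measure.restrict_apply (measurable_fst hL), convMass,
      Set.inter_comm]
    rfl
  have hfin : IsFiniteMeasure ((((volume : Measure V).prod μ).restrict S).map Prod.fst) := by
    refine ⟨?_⟩
    rw [← hmap _ MeasurableSet.univ]
    refine (convMass_le_left μ hK.measurableSet MeasurableSet.univ).trans_lt ?_
    exact ENNReal.mul_lt_top (measure_lt_top _ _) hK.measure_lt_top
  rw [hmap F hF] at hrK
  obtain ⟨L, hLF, hL, hrL⟩ := hF.exists_lt_isCompact hrK
  rw [← hmap L hL.measurableSet] at hrL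
  exact hrL.trans_le (h K hKE L hLF hK hL)

/-- If a finite measure `μ` differs from a bounded density `κ` by little on the Fourier side, the
mass of `E` and `F` is controlled by the `L¹ → L^∞` bound of `κ` and the `L² → L²` bound of the
difference. -/
theorem convMass_le_of_fourier (μ : Measure V) [IsFiniteMeasure μ] {κ : V → ℂ}
    (hκ : Integrable κ) {A δ : ℝ} (hA : ∀ u, ‖κ u‖ ≤ A)
    (hδ : ∀ ζ, ‖(∫ u, Real.fourierChar (-⟪u, ζ⟫) • (1 : ℂ) ∂μ) -
      ∫ u, Real.fourierChar (-⟪u, ζ⟫) • κ u‖ ≤ δ)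
    {E F : Set V} (hE : MeasurableSet E) (hF : MeasurableSet F)
    (hEv : volume E ≠ ∞) (hFv : volume F ≠ ∞) :
    convMass μ E F ≤ ENNReal.ofReal (A * (volume.real E * volume.real F) +
      δ * (√(volume.real E) * √(volume.real F))) := by
  have hA0 : 0 ≤ A := (norm_nonneg _).trans (hA 0)
  have hδ0 : 0 ≤ δ := (norm_nonneg _).trans (hδ 0)
  refine convMass_le_of_isCompact μ hE hF hFv fun K hKE L hLF hK hL => ?_
  have hKr : volume.real K ≤ volume.real E := measureReal_mono hKE hEv
  have hLr : volume.real L ≤ volume.real F := measureReal_mono hLF hFv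
  have hb : ∀ ε > 0, convMass μ K L ≤ ENNReal.ofReal
      (A * ((volume.real E + ε) * (volume.real F + ε)) +
        δ * (√(volume.real F + ε) * √(volume.real E + ε))) := by
    intro ε hε
    obtain ⟨f, r, hfr, hr0, hrl, hr1, hf1, hf2⟩ := exists_schwartz_of_isCompact hK hε
    obtain ⟨g, s, hgs, hs0, hsl, hs1, hg1, hg2⟩ := exists_schwartz_of_isCompact hL hε
    have hin : ∀ u p, inner ℂ (g p) (f (p - u)) = ((s p * r (p - u) : ℝ) : ℂ) := fun u p => by
      simp [hfr, hgs, mul_comm]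
    have hsc : Continuous s := by
      have : s = fun x => (g x).re := by ext x; simp [hgs]
      rw [this]; exact Complex.continuous_re.comp g.continuous
    have hrc : Continuous r := by
      have : r = fun x => (f x).re := by ext x; simp [hfr]
      rw [this]; exact Complex.continuous_re.comp f.continuous
    have hsi : Integrable s := by
      refine g.integrable.norm.congr (Filter.Eventually.of_forall fun x => ?_)
      simp [hgs, abs_of_nonneg (hs0 x)]
    have hri : Integrable r := by
      refine f.integrable.norm.congr (Filter.Eventually.of_forall fun x => ?_)
      simp [hfr, abs_of_nonneg (hr0 x)]
    -- the pairing of `g` with the translates of `f`, which dominates that of `L` with those of `K`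
    set J : V → ℝ := fun u => ∫ p, s p * r (p - u) with hJ
    have hJ' : ∀ u, ∫ p, inner ℂ (g p) (f (p - u)) = (J u : ℂ) := fun u => by
      simp_rw [hin]; rw [integral_complex_ofReal]
    have hsr : ∀ u, Integrable fun p => s p * r (p - u) := fun u =>
      hsi.mul_bdd (c := 1) (by fun_prop) (Filter.Eventually.of_forall fun p => by
        rw [Real.norm_eq_abs, abs_of_nonneg (hr0 _)]; exact hrl _)
    have hJ0 : ∀ u, 0 ≤ J u := fun u => integral_nonneg fun p => mul_nonneg (hs0 _) (hr0 _)
    have hJle : ∀ u, J u ≤ ∫ p, s p := fun u =>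
      integral_mono (hsr u) hsi fun p => mul_le_of_le_one_right (hs0 _) (hrl _)
    have hJm : StronglyMeasurable J := by
      have : Continuous fun q : V × V => s q.2 * r (q.2 - q.1) := by fun_prop
      exact this.stronglyMeasurable.integral_prod_right'
    have hJμ : Integrable J μ := by
      refine (integrable_const (∫ p, s p)).mono' hJm.aestronglyMeasurable
        (Filter.Eventually.of_forall fun u => ?_)
      rw [Real.norm_eq_abs, abs_of_nonneg (hJ0 u)]
      exact hJle u
    have hprod : Integrable (fun q : V × V => s q.2 * r (q.2 - q.1))
        ((volume : Measure V).prod volume) := by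
      have := hsi.convolution_integrand (ContinuousLinearMap.mul ℝ ℝ) hri.comp_neg
      simpa using this
    have hJv : Integrable J := hprod.integral_prod_left
    have hJint : ∫ u, J u = (∫ p, s p) * ∫ p, r p := by
      simp only [hJ]
      rw [integral_integral_swap hprod, ← integral_mul_const]
      refine integral_congr_ae (Filter.Eventually.of_forall fun p => ?_)
      simp only
      rw [integral_const_mul, integral_sub_left_eq_self]
    have hs1' : ∫ p, s p ≤ volume.real L + ε := by
      refine (le_of_eq (integral_congr_ae (Filter.Eventually.of_forall fun x => ?_))).trans hg1
      simp [hgs, abs_of_nonneg (hs0 x)]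
    have hr1' : ∫ p, r p ≤ volume.real K + ε := by
      refine (le_of_eq (integral_congr_ae (Filter.Eventually.of_forall fun x => ?_))).trans hf1
      simp [hfr, abs_of_nonneg (hr0 x)]
    have hmass : convMass μ K L ≤ ENNReal.ofReal (∫ u, J u ∂μ) := by
      rw [convMass_eq_lintegral_left μ hK.measurableSet hL.measurableSet,
        ofReal_integral_eq_lintegral_ofReal hJμ (Filter.Eventually.of_forall hJ0)]
      refine lintegral_mono fun u => ?_
      have hm : MeasurableSet {p | p - u ∈ K ∧ p ∈ L} :=
        ((measurable_id.sub_const u) hK.measurableSet).inter hL.measurableSet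
      simp only [hJ]
      rw [ofReal_integral_eq_lintegral_ofReal (hsr u)
        (Filter.Eventually.of_forall fun p => mul_nonneg (hs0 _) (hr0 _)),
        ← lintegral_indicator_one hm]
      refine lintegral_mono fun p => ?_
      by_cases hp : p ∈ {p | p - u ∈ K ∧ p ∈ L}
      · simp [hp, hr1 _ hp.1, hs1 _ hp.2]
      · simp [hp]
    have hdiff := norm_integral_sub_integral_le μ volume (integrable_const (1 : ℂ)) hκ hδ f g
    simp only [hJ', one_mul] at hdiff
    rw [integral_complex_ofReal] at hdiff
    have hκJ : ‖∫ u, κ u * (J u : ℂ)‖ ≤ A * ((volume.real E + ε) * (volume.real F + ε)) := by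
      calc _ ≤ ∫ u, A * J u := by
            refine norm_integral_le_of_norm_le (hJv.const_mul A)
              (Filter.Eventually.of_forall fun u => ?_)
            rw [norm_mul, Complex.norm_real, Real.norm_eq_abs, abs_of_nonneg (hJ0 u)]
            exact mul_le_mul_of_nonneg_right (hA u) (hJ0 u)
        _ = A * ((∫ p, r p) * ∫ p, s p) := by rw [integral_const_mul, hJint, mul_comm (∫ p, s p)]
        _ ≤ _ := by
            refine mul_le_mul_of_nonneg_left ?_ hA0
            exact mul_le_mul (by linarith) (by linarith) (integral_nonneg hs0) (by positivity)
    have hsq : δ * (√(∫ x, ‖g x‖ ^ 2) * √(∫ x, ‖f x‖ ^ 2)) ≤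
        δ * (√(volume.real F + ε) * √(volume.real E + ε)) := by
      gcongr <;> linarith
    refine hmass.trans (ENNReal.ofReal_le_ofReal ?_)
    have h3 := norm_le_norm_add_norm_sub' ((∫ u, J u ∂μ : ℝ) : ℂ) (∫ u, κ u * (J u : ℂ))
    rw [Complex.norm_real, Real.norm_eq_abs, abs_of_nonneg (integral_nonneg hJ0)] at h3
    linarith
  have ht : Filter.Tendsto (fun ε : ℝ => ENNReal.ofReal
      (A * ((volume.real E + ε) * (volume.real F + ε)) +
        δ * (√(volume.real F + ε) * √(volume.real E + ε)))) (𝓝[>] 0)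
      (𝓝 (ENNReal.ofReal (A * ((volume.real E + 0) * (volume.real F + 0)) +
        δ * (√(volume.real F + 0) * √(volume.real E + 0))))) := by
    refine Filter.Tendsto.mono_left (Continuous.tendsto ?_ 0) nhdsWithin_le_nhds
    exact ENNReal.continuous_ofReal.comp (by fun_prop)
  rw [add_zero, add_zero, mul_comm (√_)] at ht
  exact ge_of_tendsto ht (eventually_mem_nhdsWithin.mono fun ε hε => hb ε hε)

end Bound

/-! ### The Gaussian measure on a quadratic surface -/

section Gaussian

open scoped SchwartzMap FourierTransform RealInnerProductSpace Topology

variable {k l : ℕ}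

/-- The product `∏ i, (1 + (c η)_i ^ 2)`. The Fourier transform of the Gaussian measure on the
surface, at vertical frequency `η`, is bounded by a multiple of its power `-1/4`. -/
noncomputable def decayWeight (c : Matrix (Fin k) (Fin l) ℝ) (η : EuclideanSpace ℝ (Fin l)) : ℝ :=
  ∏ i, (1 + (c.mulVec η i) ^ 2)

theorem one_le_decayWeight (c : Matrix (Fin k) (Fin l) ℝ) (η : EuclideanSpace ℝ (Fin l)) :
    1 ≤ decayWeight c η :=
  (Finset.prod_const_one (s := Finset.univ)).symm.trans_le
    (Finset.prod_le_prod (fun _ _ => zero_le_one) fun _ _ => le_add_of_nonneg_right (sq_nonneg _))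

theorem one_add_sq_le_decayWeight (c : Matrix (Fin k) (Fin l) ℝ) (η : EuclideanSpace ℝ (Fin l))
    (i : Fin k) : 1 + (c.mulVec η i) ^ 2 ≤ decayWeight c η := by
  classical
  rw [decayWeight, ← Finset.mul_prod_erase _ _ (Finset.mem_univ i)]
  refine le_mul_of_one_le_right (by positivity) ?_
  exact (Finset.prod_const_one (s := Finset.univ.erase i)).symm.trans_le
    (Finset.prod_le_prod (fun _ _ => zero_le_one) fun i _ => le_add_of_nonneg_right (sq_nonneg _))

theorem contDiff_decayWeight (c : Matrix (Fin k) (Fin l) ℝ) {n : WithTop ℕ∞} :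
    ContDiff ℝ n (decayWeight c) := by
  unfold decayWeight Matrix.mulVec dotProduct
  fun_prop

theorem inner_graphMap_quadForm (c : Matrix (Fin k) (Fin l) ℝ) (y : EuclideanSpace ℝ (Fin k))
    (η : EuclideanSpace ℝ (Fin l)) :
    ⟪(graphMap (quadForm c) y).2, η⟫ = ∑ i, c.mulVec η i * y i ^ 2 := by
  simp only [graphMap, quadForm, PiLp.inner_apply, map_sum, map_mul, MvPolynomial.eval_C, map_pow,
    MvPolynomial.eval_X, RCLike.inner_apply, conj_trivial, Matrix.mulVec, dotProduct,
    Finset.sum_mul, Finset.mul_sum]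
  rw [Finset.sum_comm]
  exact Finset.sum_congr rfl fun i _ => Finset.sum_congr rfl fun j _ => by ring

/-- The Fourier transform, at horizontal frequency `ξ` and vertical frequency `η`, of the image of
`exp (-‖y‖²) dy` on the surface. -/
noncomputable def gaussTransform (c : Matrix (Fin k) (Fin l) ℝ) (ξ : EuclideanSpace ℝ (Fin k))
    (η : EuclideanSpace ℝ (Fin l)) : ℂ :=
  ∫ y : EuclideanSpace ℝ (Fin k),
    Real.fourierChar (-(⟪y, ξ⟫ + ⟪(graphMap (quadForm c) y).2, η⟫)) • (Real.exp (-‖y‖ ^ 2) : ℂ)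

/-- The transform is an explicit product of one-dimensional Gaussian integrals with complex
parameters `1 + 2 π i (c η)_i`. -/
theorem norm_gaussTransform_le (c : Matrix (Fin k) (Fin l) ℝ) (ξ : EuclideanSpace ℝ (Fin k))
    (η : EuclideanSpace ℝ (Fin l)) :
    ‖gaussTransform c ξ η‖ ≤ Real.pi ^ (k / 2 : ℝ) * decayWeight c η ^ (-(1 / 4) : ℝ) := by
  set b : Fin k → ℂ := fun i => 1 + 2 * Real.pi * (c.mulVec η i : ℂ) * Complex.I with hb
  set a : Fin k → ℂ := fun i => -2 * Real.pi * (ξ i : ℂ) * Complex.I with ha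
  have hbre : ∀ i, (b i).re = 1 := fun i => by simp [hb]
  have h1 : gaussTransform c ξ η =
      ∏ i, (Real.pi / b i) ^ (1 / 2 : ℂ) * Complex.exp (a i ^ 2 / (4 * b i)) := by
    rw [← GaussianFourier.integral_cexp_neg_sum_mul_add (fun i => by simp [hbre]) a,
      gaussTransform, ← (PiLp.volume_preserving_toLp (Fin k)).integral_comp
      (MeasurableEquiv.toLp 2 _).measurableEmbedding]
    refine integral_congr_ae (Filter.Eventually.of_forall fun y => ?_)
    simp only
    rw [inner_graphMap_quadForm, Circle.smul_def, Real.fourierChar_apply, smul_eq_mul,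
      Complex.ofReal_exp, ← Complex.exp_add, EuclideanSpace.norm_sq_eq, PiLp.inner_apply]
    congr 1
    simp only [hb, ha, RCLike.inner_apply, conj_trivial, Real.norm_eq_abs, sq_abs]
    push_cast
    simp only [mul_add, add_mul, Finset.mul_sum, Finset.sum_mul,
      ← Finset.sum_neg_distrib, neg_add, ← Finset.sum_add_distrib, mul_neg, neg_mul]
    exact Finset.sum_congr rfl fun i _ => by ring
  rw [h1, norm_prod, decayWeight, ← Real.finsetProd_rpow _ _ (fun i _ => by positivity)]
  have : Real.pi ^ (k / 2 : ℝ) = ∏ _i : Fin k, Real.pi ^ (1 / 2 : ℝ) := by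
    rw [Finset.prod_const, Finset.card_univ, Fintype.card_fin,
      ← Real.rpow_mul_natCast Real.pi_pos.le]
    congr 1; ring
  rw [this, ← Finset.prod_mul_distrib]
  refine Finset.prod_le_prod (fun i _ => norm_nonneg _) fun i _ => ?_
  have hb0 : b i ≠ 0 := fun h => by simpa [h] using hbre i
  have hnb : (1 + (c.mulVec η i) ^ 2) ^ (1 / 2 : ℝ) ≤ ‖b i‖ := by
    rw [← Real.sqrt_eq_rpow, Complex.norm_def, Complex.normSq_apply]
    refine Real.sqrt_le_sqrt ?_
    have him : (b i).im = 2 * Real.pi * c.mulVec η i := by simp [hb]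
    rw [hbre, him]
    nlinarith [sq_nonneg (c.mulVec η i), Real.pi_gt_three,
      mul_nonneg (sq_nonneg (c.mulVec η i)) Real.pi_pos.le,
      mul_nonneg (sq_nonneg (c.mulVec η i)) (sq_nonneg (Real.pi - 1))]
  have hexp : ‖Complex.exp (a i ^ 2 / (4 * b i))‖ ≤ 1 := by
    rw [Complex.norm_exp, Real.exp_le_one_iff]
    have : a i ^ 2 / (4 * b i) = ((-(Real.pi ^ 2 * ξ i ^ 2) : ℝ) : ℂ) * (b i)⁻¹ := by
      simp only [ha]
      push_cast
      field_simp
      linear_combination (4 * (ξ i : ℂ) ^ 2) * Complex.I_sq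
    rw [this, Complex.re_ofReal_mul, Complex.inv_re, hbre]
    have := Complex.normSq_nonneg (b i)
    have : 0 ≤ 1 / Complex.normSq (b i) := by positivity
    nlinarith [mul_nonneg (mul_nonneg (sq_nonneg Real.pi) (sq_nonneg (ξ i))) this]
  have hpow : ‖((Real.pi : ℂ) / b i) ^ (1 / 2 : ℂ)‖ ≤
      Real.pi ^ (1 / 2 : ℝ) * (1 + (c.mulVec η i) ^ 2) ^ (-(1 / 4) : ℝ) := by
    have : (1 / 2 : ℂ) = ((1 / 2 : ℝ) : ℂ) := by push_cast; rfl
    rw [this, Complex.norm_cpow_real, norm_div, Complex.norm_real, Real.norm_eq_abs,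
      abs_of_pos Real.pi_pos, Real.div_rpow Real.pi_pos.le (norm_nonneg _), div_eq_mul_inv]
    refine mul_le_mul_of_nonneg_left ?_ (by positivity)
    rw [← Real.rpow_neg (norm_nonneg _)]
    refine (Real.rpow_le_rpow_of_nonpos (by positivity) hnb (by norm_num)).trans_eq ?_
    rw [← Real.rpow_mul (by positivity)]
    norm_num
  rw [norm_mul]
  exact (mul_le_of_le_one_right (norm_nonneg _) hexp).trans hpow

end Gaussian

/-! ### Sublevel sets of the decay weight -/

section Sublevel

variable {k l : ℕ}

theorem lintegral_prod_rpow_mulVec_lt_top {M : Matrix (Fin l) (Fin l) ℝ} (hM : M.det ≠ 0) {a : ℝ}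
    (ha : 1 < a) :
    ∫⁻ η : EuclideanSpace ℝ (Fin l),
      ∏ j, ENNReal.ofReal ((1 + (M.mulVec η j) ^ 2) ^ (-a / 2)) < ∞ := by
  have h1 : Integrable (fun t : ℝ => (1 + t ^ 2) ^ (-a / 2)) := by
    simpa using
      integrable_rpow_neg_one_add_norm_sq (E := ℝ) (μ := volume) (r := a) (by simpa using ha)
  have h2 : Integrable (fun t : Fin l → ℝ => ∏ j, (1 + t j ^ 2) ^ (-a / 2)) :=
    Integrable.fintype_prod fun _ => h1
  have hmeas : Measurable fun t : Fin l → ℝ => ∏ j, ENNReal.ofReal ((1 + t j ^ 2) ^ (-a / 2)) := by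
    fun_prop
  have h3 : ∫⁻ t : Fin l → ℝ, ∏ j, ENNReal.ofReal ((1 + t j ^ 2) ^ (-a / 2)) < ∞ := by
    refine h2.lintegral_lt_top.trans_eq' (lintegral_congr fun t => ?_)
    rw [ENNReal.ofReal_prod_of_nonneg fun j _ => by positivity]
  have hlin : Measurable (Matrix.toLin' M) :=
    (LinearMap.continuous_of_finiteDimensional _).measurable
  calc _ = ∫⁻ t : Fin l → ℝ, ∏ j, ENNReal.ofReal ((1 + (Matrix.toLin' M t j) ^ 2) ^ (-a / 2)) :=
        (PiLp.volume_preserving_ofLp (Fin l)).lintegral_comp (hmeas.comp hlin)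
    _ = ∫⁻ t, ∏ j, ENNReal.ofReal ((1 + t j ^ 2) ^ (-a / 2))
          ∂(Measure.map (Matrix.toLin' M) volume) :=
        (lintegral_map hmeas hlin).symm
    _ < ∞ := by
        rw [Real.map_matrix_volume_pi_eq_smul_volume_pi hM, lintegral_smul_measure]
        exact ENNReal.mul_lt_top ENNReal.ofReal_lt_top h3

/-- Hölder's inequality over the `k` cyclic intervals of `l` rows reduces the integrability of
`decayWeight c ^ (-s / 2)` to that of products over the rows of invertible submatrices. -/
theorem lintegral_decayWeight_rpow_lt_top (hl : 1 ≤ l) (hlk : l ≤ k) {c : Matrix (Fin k) (Fin l) ℝ}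
    (hc : ConditionStar c) {s : ℝ} (hs : (l : ℝ) / k < s) :
    ∫⁻ η, ENNReal.ofReal (decayWeight c η ^ (-s / 2)) < ∞ := by
  have hk : 0 < k := by omega
  have : NeZero k := ⟨hk.ne'⟩
  have hk' : (0 : ℝ) < k := by exact_mod_cast hk
  have hl' : (0 : ℝ) < l := by exact_mod_cast hl
  set a : ℝ := s * k / l with ha
  have ha1 : 1 < a := by
    rw [ha, lt_div_iff₀ hl', one_mul]; exact (div_lt_iff₀ hk').1 hs
  -- `r i` enumerates the cyclic interval of `l` rows starting at `i`
  let r : Fin k → Fin l ↪ Fin k := fun i =>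
    ⟨fun j => i + Fin.castLE hlk j, fun j j' h => Fin.castLE_injective hlk (add_left_cancel h)⟩
  let g : Fin k → EuclideanSpace ℝ (Fin l) → ℝ≥0∞ := fun i η =>
    ∏ j, ENNReal.ofReal ((1 + ((c.submatrix (r i) id).mulVec η j) ^ 2) ^ (-a / 2))
  have hg : ∀ i, Measurable (g i) := fun i => by
    have : Continuous fun η : EuclideanSpace ℝ (Fin l) => (c.submatrix (r i) id).mulVec η := by
      unfold Matrix.mulVec dotProduct; fun_prop
    have h' : ∀ j, Measurable fun η : EuclideanSpace ℝ (Fin l) =>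
        (c.submatrix (r i) id).mulVec η j := fun j => ((continuous_apply j).comp this).measurable
    exact Finset.measurable_prod _ fun j _ => by
      have := h' j
      fun_prop
  -- every row lies in exactly `l` of the `k` intervals
  have heq : ∀ η, ENNReal.ofReal (decayWeight c η ^ (-s / 2)) = ∏ i, g i η ^ (1 / k : ℝ) := by
    intro η
    simp only [g]
    have h1 : ∀ i, (∏ j, ENNReal.ofReal
        ((1 + ((c.submatrix (r i) id).mulVec η j) ^ 2) ^ (-a / 2))) ^ (1 / k : ℝ) =
        ∏ j : Fin l, ENNReal.ofReal
          ((1 + (c.mulVec η (i + Fin.castLE hlk j)) ^ 2) ^ (-s / 2 * (1 / l))) := by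
      intro i
      rw [← ENNReal.prod_rpow_of_nonneg (by positivity)]
      refine Finset.prod_congr rfl fun j _ => ?_
      rw [ENNReal.ofReal_rpow_of_nonneg (by positivity) (by positivity),
        ← Real.rpow_mul (by positivity)]
      have : -a / 2 * (1 / k) = -s / 2 * (1 / l) := by rw [ha]; field_simp
      rw [this]; rfl
    simp_rw [h1]
    rw [Finset.prod_comm]
    have h2 : ∀ j : Fin l, ∏ i, ENNReal.ofReal
        ((1 + (c.mulVec η (i + Fin.castLE hlk j)) ^ 2) ^ (-s / 2 * (1 / l))) =
        ENNReal.ofReal (decayWeight c η ^ (-s / 2 * (1 / l))) := fun j => by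
      rw [decayWeight, ← Real.finsetProd_rpow _ _ (fun i _ => by positivity),
        ENNReal.ofReal_prod_of_nonneg fun i _ => by positivity]
      exact Fintype.prod_equiv (Equiv.addRight (Fin.castLE hlk j)) _ _ fun i => rfl
    have hW : 0 ≤ decayWeight c η := zero_le_one.trans (one_le_decayWeight c η)
    rw [Finset.prod_congr rfl fun j _ => h2 j, Finset.prod_const, Finset.card_univ,
      Fintype.card_fin, ← ENNReal.ofReal_pow (by positivity), ← Real.rpow_mul_natCast hW]
    congr 2
    field_simp
  simp_rw [heq]
  refine (ENNReal.lintegral_prod_norm_pow_le _ (fun i _ => (hg i).aemeasurable) ?_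
    fun i _ => by positivity).trans_lt ?_
  · rw [Finset.sum_const, Finset.card_univ, Fintype.card_fin, nsmul_eq_mul]
    field_simp
  · refine ENNReal.prod_lt_top fun i _ => ENNReal.rpow_lt_top_of_nonneg (by positivity) ?_
    exact (lintegral_prod_rpow_mulVec_lt_top (hc (r i)) ha1).ne

/-- Chebyshev's inequality for the integral of `decayWeight c ^ (-s / 2)`. -/
theorem exists_volume_decayWeight_le (hl : 1 ≤ l) (hlk : l ≤ k) {c : Matrix (Fin k) (Fin l) ℝ}
    (hc : ConditionStar c) {s : ℝ} (hs : (l : ℝ) / k < s) :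
    ∃ C : ℝ, 0 ≤ C ∧ ∀ R : ℝ, 0 < R → volume {η | decayWeight c η ≤ 2 * R ^ 2} ≤
      ENNReal.ofReal (C * R ^ s) := by
  have hI := lintegral_decayWeight_rpow_lt_top hl hlk hc hs
  set I := ∫⁻ η, ENNReal.ofReal (decayWeight c η ^ (-s / 2)) with hIdef
  have hs0 : 0 < s := lt_of_le_of_lt (by positivity) hs
  refine ⟨I.toReal * 2 ^ (s / 2), by positivity, fun R hR => ?_⟩
  have hm : Measurable fun η => ENNReal.ofReal (decayWeight c η ^ (-s / 2)) := by
    have := (contDiff_decayWeight c (n := 0)).continuous.measurable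
    fun_prop
  have hε : 0 < (2 * R ^ 2) ^ (-s / 2) := by positivity
  calc volume {η | decayWeight c η ≤ 2 * R ^ 2}
      ≤ volume {η | ENNReal.ofReal ((2 * R ^ 2) ^ (-s / 2)) ≤
          ENNReal.ofReal (decayWeight c η ^ (-s / 2))} := by
        refine measure_mono fun η hη => ENNReal.ofReal_le_ofReal ?_
        exact Real.rpow_le_rpow_of_nonpos (zero_lt_one.trans_le (one_le_decayWeight c η)) hη
          (by linarith)
    _ ≤ I / ENNReal.ofReal ((2 * R ^ 2) ^ (-s / 2)) :=
        meas_ge_le_lintegral_div hm.aemeasurable (by simpa using hε) ENNReal.ofReal_ne_top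
    _ = _ := by
        conv_lhs => rw [← ENNReal.ofReal_toReal hI.ne, ← ENNReal.ofReal_div_of_pos hε]
        congr 1
        rw [div_eq_mul_inv, ← Real.rpow_neg (by positivity),
          Real.mul_rpow (by norm_num) (by positivity),
          ← Real.rpow_natCast R 2, ← Real.rpow_mul hR.le, mul_assoc]
        congr 3 <;> push_cast <;> ring

end Sublevel

/-! ### Frequency cutoffs and smeared densities -/

section Cutoff

open scoped SchwartzMap FourierTransform RealInnerProductSpace Topology

variable {k l : ℕ}

theorem isBounded_decayWeight_le (hlk : l ≤ k) {c : Matrix (Fin k) (Fin l) ℝ}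
    (hc : ConditionStar c) (M : ℝ) : Bornology.IsBounded {η | decayWeight c η ≤ M} := by
  set B := c.submatrix (Fin.castLEEmb hlk) id
  have hB : B.det ≠ 0 := hc _
  let A : EuclideanSpace ℝ (Fin l) →ₗ[ℝ] (Fin l → ℝ) :=
    B.mulVecLin ∘ₗ (WithLp.linearEquiv 2 ℝ (Fin l → ℝ)).toLinearMap
  have hA : A.ker = ⊥ := by
    refine LinearMap.ker_eq_bot.2 ?_
    exact (Matrix.mulVec_injective_iff_isUnit.2 ((Matrix.isUnit_iff_isUnit_det _).2
      (isUnit_iff_ne_zero.2 hB))).comp (WithLp.linearEquiv 2 ℝ (Fin l → ℝ)).injective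
  obtain ⟨K, -, hK⟩ := A.exists_antilipschitzWith hA
  refine (hK.isBounded_preimage (Metric.isBounded_closedBall (x := 0) (r := √M))).subset ?_
  intro η hη
  rw [Set.mem_preimage, mem_closedBall_zero_iff, pi_norm_le_iff_of_nonneg (Real.sqrt_nonneg _)]
  intro j
  refine Real.abs_le_sqrt ?_
  have := (one_add_sq_le_decayWeight c η (Fin.castLEEmb hlk j)).trans hη
  have h2 : A η j = c.mulVec η (Fin.castLEEmb hlk j) := rfl
  rw [h2]; linarith

/-- A smooth cutoff to the region where `decayWeight c` is at most `R ^ 2`. -/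
theorem exists_cutoff (hlk : l ≤ k) {c : Matrix (Fin k) (Fin l) ℝ}
    (hc : ConditionStar c) {R : ℝ} (hR : 0 < R) :
    ∃ χ : 𝓢(EuclideanSpace ℝ (Fin l), ℂ), (∀ η, ‖χ η‖ ≤ 1) ∧ (∀ η, ‖1 - χ η‖ ≤ 1) ∧
      (∀ η, decayWeight c η ≤ R ^ 2 → χ η = 1) ∧
      ∫ η, ‖χ η‖ ≤ volume.real {η | decayWeight c η ≤ 2 * R ^ 2} := by
  set h : EuclideanSpace ℝ (Fin l) → ℝ :=
    fun η => Real.smoothTransition (2 - decayWeight c η / R ^ 2)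
    with hh
  have hsm : ContDiff ℝ (⊤ : ℕ∞) fun η => (h η : ℂ) := by
    refine Complex.ofRealCLM.contDiff.comp (Real.smoothTransition.contDiff.comp ?_)
    exact contDiff_const.sub ((contDiff_decayWeight c).div_const _)
  have hR2 : 0 < R ^ 2 := by positivity
  have h0 : ∀ η, ¬ decayWeight c η ≤ 2 * R ^ 2 → h η = 0 := fun η hη => by
    refine Real.smoothTransition.zero_of_nonpos ?_
    have : 2 ≤ decayWeight c η / R ^ 2 := by rw [le_div_iff₀ hR2]; linarith
    linarith
  have hb := isBounded_decayWeight_le hlk hc (2 * R ^ 2)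
  have hcl : IsClosed {η | decayWeight c η ≤ 2 * R ^ 2} :=
    isClosed_le (contDiff_decayWeight c (n := 0)).continuous continuous_const
  have hcs : HasCompactSupport fun η => (h η : ℂ) := by
    refine HasCompactSupport.of_support_subset_isCompact
      (Metric.isCompact_of_isClosed_isBounded hcl hb) fun η hη => ?_
    by_contra hn
    exact hη (by simp [h0 η hn])
  have hn : ∀ η, 0 ≤ h η := fun η => Real.smoothTransition.nonneg _
  have hle : ∀ η, h η ≤ 1 := fun η => Real.smoothTransition.le_one _
  refine ⟨hcs.toSchwartzMap hsm, fun η => ?_, fun η => ?_, fun η hη => ?_, ?_⟩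
  · simpa [abs_of_nonneg (hn η)] using hle η
  · have : (1 : ℂ) - hcs.toSchwartzMap hsm η = ((1 - h η : ℝ) : ℂ) := by simp
    rw [this, Complex.norm_real, Real.norm_eq_abs, abs_of_nonneg (by linarith [hle η])]
    linarith [hn η]
  · have : h η = 1 := by
      refine Real.smoothTransition.one_of_one_le ?_
      have : decayWeight c η / R ^ 2 ≤ 1 := by rw [div_le_one hR2]; exact hη
      linarith
    simp [this]
  · have hi : Integrable ({η | decayWeight c η ≤ 2 * R ^ 2}.indicator fun _ => (1 : ℝ)) :=
      (integrable_indicator_iff hcl.measurableSet).2 (integrableOn_const hb.measure_lt_top.ne)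
    refine (integral_mono_of_nonneg (Filter.Eventually.of_forall fun x => norm_nonneg _) hi
      (Filter.Eventually.of_forall fun η => ?_)).trans_eq ?_
    · by_cases hη : η ∈ {η | decayWeight c η ≤ 2 * R ^ 2}
      · simpa [Set.indicator_of_mem hη, abs_of_nonneg (hn η)] using hle η
      · simp [Set.indicator_of_notMem hη, h0 η hη]
    · rw [integral_indicator hcl.measurableSet]; simp

end Cutoff

section Kernel

open scoped SchwartzMap FourierTransform RealInnerProductSpace Topology

variable {k l : ℕ}

/-- The density `exp (-‖y‖²) ψ (z - Φ y)` on `ℝ^k × ℝ^l`: the Gaussian measure on the graph of `Φ`,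
convolved with `ψ` in the vertical direction. -/
noncomputable def smearedDensity (c : Matrix (Fin k) (Fin l) ℝ)
    (ψ : EuclideanSpace ℝ (Fin l) → ℂ) (p : Space k l) : ℂ :=
  (Real.exp (-‖p.1‖ ^ 2) : ℂ) * ψ (p.2 - (graphMap (quadForm c) p.1).2)

theorem integrable_exp_neg_norm_sq {V : Type*} [NormedAddCommGroup V] [InnerProductSpace ℝ V]
    [FiniteDimensional ℝ V] [MeasurableSpace V] [BorelSpace V] :
    Integrable fun y : V => Real.exp (-‖y‖ ^ 2) := by
  have := (GaussianFourier.integrable_cexp_neg_mul_sq_norm_add (b := 1) (V := V) (by simp) 0 0).norm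
  refine this.congr (Filter.Eventually.of_forall fun y => ?_)
  simp only [Complex.norm_exp]
  congr 1
  simp [← Complex.ofReal_pow]

theorem continuous_smearedDensity (c : Matrix (Fin k) (Fin l) ℝ)
    {ψ : EuclideanSpace ℝ (Fin l) → ℂ} (hψ : Continuous ψ) : Continuous (smearedDensity c ψ) := by
  have h : Continuous fun p : Space k l => (graphMap (quadForm c) p.1).2 :=
    (continuous_snd.comp (continuous_graphMap (quadForm c))).comp continuous_fst
  have h1 : Continuous fun p : Space k l => (Real.exp (-‖p.1‖ ^ 2) : ℂ) := by fun_prop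
  exact h1.mul (hψ.comp (continuous_snd.sub h))

theorem integrable_smearedDensity (c : Matrix (Fin k) (Fin l) ℝ)
    (ψ : 𝓢(EuclideanSpace ℝ (Fin l), ℂ)) : Integrable (smearedDensity c ψ) := by
  have hm := (continuous_smearedDensity c ψ.continuous).aestronglyMeasurable
    (μ := (volume : Measure (Space k l)))
  refine (integrable_prod_iff hm).2 ⟨Filter.Eventually.of_forall fun y => ?_, ?_⟩
  · have : Integrable fun z => ψ (z - (graphMap (quadForm c) y).2) :=
      (ψ.integrable (μ := volume)).comp_sub_right _
    exact this.const_mul (Real.exp (-‖y‖ ^ 2) : ℂ)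
  · have : ∀ y : EuclideanSpace ℝ (Fin k), ∫ z, ‖smearedDensity c ψ (y, z)‖ =
        Real.exp (-‖y‖ ^ 2) * ∫ z, ‖ψ z‖ := fun y => by
      simp only [smearedDensity, norm_mul]
      rw [integral_const_mul, integral_sub_right_eq_self (fun z => ‖ψ z‖), Complex.norm_real,
        Real.norm_eq_abs, Real.abs_exp]
    simp_rw [this]
    exact integrable_exp_neg_norm_sq.mul_const _

/-- Convolution with `ψ` in the vertical direction multiplies the Fourier transform by `𝓕 ψ`. -/
theorem integral_fourierChar_smul_smearedDensity (c : Matrix (Fin k) (Fin l) ℝ)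
    (ψ : 𝓢(EuclideanSpace ℝ (Fin l), ℂ)) (ξ : EuclideanSpace ℝ (Fin k))
    (η : EuclideanSpace ℝ (Fin l)) :
    ∫ p : Space k l, Real.fourierChar (-(⟪p.1, ξ⟫ + ⟪p.2, η⟫)) • smearedDensity c ψ p =
      gaussTransform c ξ η * 𝓕 ψ η := by
  have hint : Integrable fun p : Space k l =>
      Real.fourierChar (-(⟪p.1, ξ⟫ + ⟪p.2, η⟫)) • smearedDensity c ψ p := by
    have hc : Continuous fun p : Space k l => Real.fourierChar (-(⟪p.1, ξ⟫ + ⟪p.2, η⟫)) :=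
      Real.continuous_fourierChar.comp (by fun_prop)
    refine (integrable_smearedDensity c ψ).mono
      (hc.smul (continuous_smearedDensity c ψ.continuous)).aestronglyMeasurable ?_
    exact Filter.Eventually.of_forall fun p => (Circle.norm_smul _ _).le
  rw [Measure.volume_eq_prod] at hint ⊢
  rw [integral_prod _ hint, gaussTransform, ← integral_mul_const]
  refine integral_congr_ae (Filter.Eventually.of_forall fun y => ?_)
  simp only [smearedDensity]
  set b := (graphMap (quadForm c) y).2
  have h1 := fourier_compSubConst ψ b η
  rw [SchwartzMap.fourier_coe, Real.fourier_eq] at h1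
  simp only [SchwartzMap.compSubConstCLM_apply] at h1
  have h2 : ∀ z, Real.fourierChar (-(⟪y, ξ⟫ + ⟪z, η⟫)) • ((Real.exp (-‖y‖ ^ 2) : ℂ) * ψ (z - b)) =
      (Real.fourierChar (-⟪y, ξ⟫) * (Real.exp (-‖y‖ ^ 2) : ℂ)) *
        (Real.fourierChar (-⟪z, η⟫) • ψ (z - b)) := fun z => by
    rw [neg_add, AddChar.map_add_eq_mul]
    simp only [Circle.smul_def, smul_eq_mul, Circle.coe_mul]
    ring
  simp_rw [h2]
  rw [integral_const_mul, h1, neg_add, AddChar.map_add_eq_mul]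
  simp only [Circle.smul_def, smul_eq_mul, Circle.coe_mul]
  ring

end Kernel

/-! ### Mass estimates for the surface -/

section Restricted

open scoped SchwartzMap FourierTransform RealInnerProductSpace Topology

variable {k l : ℕ}

/-- The image on the surface of the measure `exp (-‖y‖²) dy`. -/
noncomputable def gaussSurface (c : Matrix (Fin k) (Fin l) ℝ) : Measure (Space k l) :=
  ((volume : Measure (EuclideanSpace ℝ (Fin k))).withDensity
    fun y => ENNReal.ofReal (Real.exp (-‖y‖ ^ 2))).map (graphMap (quadForm c))

instance (c : Matrix (Fin k) (Fin l) ℝ) : IsFiniteMeasure (gaussSurface c) := by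
  have : IsFiniteMeasure ((volume : Measure (EuclideanSpace ℝ (Fin k))).withDensity
      fun y => ENNReal.ofReal (Real.exp (-‖y‖ ^ 2))) :=
    isFiniteMeasure_withDensity_ofReal integrable_exp_neg_norm_sq.2
  unfold gaussSurface
  infer_instance

instance (Φ : Fin l → MvPolynomial (Fin k) ℝ) :
    IsFiniteMeasure (surfaceMeasure (Metric.ball 0 1) Φ) := by
  have : IsFiniteMeasure ((volume : Measure (EuclideanSpace ℝ (Fin k))).restrict
    (Metric.ball 0 1)) := ⟨by simpa using Metric.isBounded_ball.measure_lt_top⟩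
  unfold surfaceMeasure
  infer_instance

theorem surfaceMeasure_le_gaussSurface (c : Matrix (Fin k) (Fin l) ℝ) {A : Set (Space k l)}
    (hA : MeasurableSet A) : surfaceMeasure (Metric.ball 0 1) (quadForm c) A ≤
      ENNReal.ofReal (Real.exp 1) * gaussSurface c A := by
  have hm := (continuous_graphMap (quadForm c)).measurable
  rw [surfaceMeasure, gaussSurface, Measure.map_apply hm hA, Measure.map_apply hm hA,
    Measure.restrict_apply (hm hA), withDensity_apply _ (hm hA), ← setLIntegral_one,
    ← lintegral_const_mul _ (by fun_prop)]
  refine (setLIntegral_mono (by fun_prop) fun y hy => ?_).trans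
    (lintegral_mono_set Set.inter_subset_left)
  rw [← ENNReal.ofReal_mul (by positivity), ← Real.exp_add, ENNReal.one_le_ofReal,
    Real.one_le_exp_iff]
  have h1 : ‖y‖ < 1 := by simpa using hy.2
  nlinarith [norm_nonneg y]

theorem convMass_surfaceMeasure_le (c : Matrix (Fin k) (Fin l) ℝ) {E F : Set (Space k l)}
    (hE : MeasurableSet E) (hF : MeasurableSet F) :
    convMass (surfaceMeasure (Metric.ball 0 1) (quadForm c)) E F ≤
      ENNReal.ofReal (Real.exp 1) * convMass (gaussSurface c) E F := by
  rw [convMass_eq_lintegral_right _ hE hF, convMass_eq_lintegral_right _ hE hF,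
    ← lintegral_const_mul' _ _ ENNReal.ofReal_ne_top]
  exact lintegral_mono fun z => surfaceMeasure_le_gaussSurface c (measurable_id.const_sub z hE)

theorem convMass_map_toLp (μ : Measure (Space k l)) [IsFiniteMeasure μ] {E F : Set (Space k l)}
    (hE : MeasurableSet E) (hF : MeasurableSet F) :
    convMass (μ.map (WithLp.toLp 2)) (WithLp.ofLp ⁻¹' E) (WithLp.ofLp ⁻¹' F) = convMass μ E F := by
  have hmp := WithLp.volume_preserving_ofLp (EuclideanSpace ℝ (Fin k)) (EuclideanSpace ℝ (Fin l))
  have ht : Measurable (WithLp.toLp 2 : Space k l → _) := WithLp.measurable_toLp 2 _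
  have hE' := hmp.measurable hE
  have hF' := hmp.measurable hF
  rw [convMass_eq_lintegral_left _ hE' hF', convMass_eq_lintegral_left _ hE hF, lintegral_map _ ht]
  · refine lintegral_congr fun u => ?_
    exact hmp.measure_preimage
      (((measurable_id.sub_const u) hE).inter hF).nullMeasurableSet
  · exact measurable_measure_prodMk_right (measurableSet_convMass hE' hF')

theorem integral_fourierChar_gaussSurface (c : Matrix (Fin k) (Fin l) ℝ)
    (ζ : WithLp 2 (EuclideanSpace ℝ (Fin k) × EuclideanSpace ℝ (Fin l))) :
    ∫ u, Real.fourierChar (-⟪u, ζ⟫) • (1 : ℂ) ∂((gaussSurface c).map (WithLp.toLp 2)) =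
      gaussTransform c ζ.fst ζ.snd := by
  have ht : Measurable (WithLp.toLp 2 : Space k l → _) := WithLp.measurable_toLp 2 _
  have hc : Continuous fun u : WithLp 2 (EuclideanSpace ℝ (Fin k) × EuclideanSpace ℝ (Fin l)) =>
      Real.fourierChar (-⟪u, ζ⟫) • (1 : ℂ) :=
    (Real.continuous_fourierChar.comp (by fun_prop)).smul continuous_const
  have hc' : Continuous fun u : Space k l =>
      Real.fourierChar (-⟪WithLp.toLp 2 u, ζ⟫) • (1 : ℂ) :=
    hc.comp (WithLp.prod_continuous_toLp 2 _ _)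
  rw [integral_map ht.aemeasurable hc.aestronglyMeasurable, gaussSurface,
    integral_map (continuous_graphMap _).measurable.aemeasurable
      hc'.aestronglyMeasurable,
    integral_withDensity_eq_integral_toReal_smul (by fun_prop)
      (Filter.Eventually.of_forall fun _ => ENNReal.ofReal_lt_top), gaussTransform]
  refine integral_congr_ae (Filter.Eventually.of_forall fun y => ?_)
  simp only [WithLp.prod_inner_apply, ENNReal.toReal_ofReal (Real.exp_pos _).le]
  simp only [Circle.smul_def, smul_eq_mul, mul_one, Complex.real_smul]
  exact mul_comm _ _

/-- The mass for the Gaussian measure, with the frequencies split according to the size of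
`decayWeight c`. -/
theorem exists_convMass_gaussSurface_le (hl : 1 ≤ l) (hlk : l ≤ k) {c : Matrix (Fin k) (Fin l) ℝ}
    (hc : ConditionStar c) {s : ℝ} (hs : (l : ℝ) / k < s) :
    ∃ C : ℝ, 0 ≤ C ∧ ∀ R : ℝ, 0 < R → ∀ E F : Set (Space k l), MeasurableSet E → MeasurableSet F →
      volume E ≠ ∞ → volume F ≠ ∞ → convMass (gaussSurface c) E F ≤
        ENNReal.ofReal (C * (R ^ s * (volume.real E * volume.real F) +
          R ^ (-(1 / 2) : ℝ) * (√(volume.real E) * √(volume.real F)))) := by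
  obtain ⟨C, hC0, hC⟩ := exists_volume_decayWeight_le hl hlk hc hs
  set D : ℝ := Real.pi ^ (k / 2 : ℝ)
  have hD : 0 ≤ D := by positivity
  refine ⟨C + D, by positivity, fun R hR E F hE hF hEv hFv => ?_⟩
  obtain ⟨χ, hχ1, hχ2, hχ3, hχ4⟩ := exists_cutoff hlk hc hR
  set ψ := 𝓕⁻ χ with hψ
  have hvol : volume.real {η | decayWeight c η ≤ 2 * R ^ 2} ≤ C * R ^ s :=
    ENNReal.toReal_le_of_le_ofReal (by positivity) (hC R hR)
  have hψle : ∀ z, ‖ψ z‖ ≤ C * R ^ s := fun z => by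
    refine le_trans ?_ (hχ4.trans hvol)
    rw [hψ, SchwartzMap.fourierInv_coe, Real.fourierInv_eq]
    refine (norm_integral_le_integral_norm _).trans_eq ?_
    simp only [Circle.norm_smul]
  have hmp := WithLp.volume_preserving_ofLp (EuclideanSpace ℝ (Fin k)) (EuclideanSpace ℝ (Fin l))
  have hmt := WithLp.volume_preserving_toLp (EuclideanSpace ℝ (Fin k)) (EuclideanSpace ℝ (Fin l))
  have hemb : MeasurableEmbedding (WithLp.toLp 2 : Space k l → _) :=
    (MeasurableEquiv.toLp 2 (Space k l)).measurableEmbedding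
  -- the part of the measure at vertical frequencies with `decayWeight c` of size at most `R ^ 2`
  set κ : WithLp 2 (EuclideanSpace ℝ (Fin k) × EuclideanSpace ℝ (Fin l)) → ℂ :=
    fun v => smearedDensity c ψ v.ofLp with hκ
  have hκi : Integrable κ := hmp.integrable_comp_of_integrable (integrable_smearedDensity c ψ)
  have hκA : ∀ v, ‖κ v‖ ≤ C * R ^ s := fun v => by
    simp only [hκ, smearedDensity, norm_mul, Complex.norm_real, Real.norm_eq_abs, Real.abs_exp]
    refine (mul_le_of_le_one_left (norm_nonneg _) ?_).trans (hψle _)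
    rw [Real.exp_le_one_iff]
    exact neg_nonpos.2 (sq_nonneg _)
  have hfar : ∀ ζ, ‖(∫ u, Real.fourierChar (-⟪u, ζ⟫) • (1 : ℂ)
      ∂((gaussSurface c).map (WithLp.toLp 2))) - ∫ u, Real.fourierChar (-⟪u, ζ⟫) • κ u‖ ≤
      D * R ^ (-(1 / 2) : ℝ) := fun ζ => by
    have h1 : ∫ u, Real.fourierChar (-⟪u, ζ⟫) • κ u = gaussTransform c ζ.fst ζ.snd * χ ζ.snd := by
      have := integral_fourierChar_smul_smearedDensity c ψ ζ.fst ζ.snd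
      rw [hψ, FourierTransform.fourier_fourierInv_eq] at this
      rw [← this, ← hmt.integral_comp hemb]
      simp only [hκ, WithLp.prod_inner_apply]
      rfl
    rw [h1, integral_fourierChar_gaussSurface, ← mul_one_sub, norm_mul]
    have hg := norm_gaussTransform_le c ζ.fst ζ.snd
    by_cases hW : decayWeight c ζ.snd ≤ R ^ 2
    · rw [hχ3 _ hW, sub_self, norm_zero, mul_zero]
      positivity
    · refine (mul_le_of_le_one_right (norm_nonneg _) (hχ2 _)).trans (hg.trans ?_)
      refine mul_le_mul_of_nonneg_left ?_ hD
      refine (Real.rpow_le_rpow_of_nonpos (by positivity) (not_le.1 hW).le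
        (by norm_num)).trans_eq ?_
      rw [← Real.rpow_natCast R 2, ← Real.rpow_mul hR.le]
      norm_num
  have hEr : volume.real (WithLp.ofLp ⁻¹' E : Set (WithLp 2 (EuclideanSpace ℝ (Fin k) ×
      EuclideanSpace ℝ (Fin l)))) = volume.real E := by
    rw [measureReal_def, hmp.measure_preimage hE.nullMeasurableSet, measureReal_def]
  have hFr : volume.real (WithLp.ofLp ⁻¹' F : Set (WithLp 2 (EuclideanSpace ℝ (Fin k) ×
      EuclideanSpace ℝ (Fin l)))) = volume.real F := by
    rw [measureReal_def, hmp.measure_preimage hF.nullMeasurableSet, measureReal_def]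
  have := Measure.isFiniteMeasure_map (gaussSurface c) (WithLp.toLp 2)
  have key := convMass_le_of_fourier ((gaussSurface c).map (WithLp.toLp 2)) hκi hκA hfar
    (hmp.measurable hE) (hmp.measurable hF)
    (by rwa [hmp.measure_preimage hE.nullMeasurableSet])
    (by rwa [hmp.measure_preimage hF.nullMeasurableSet])
  rw [convMass_map_toLp _ hE hF, hEr, hFr] at key
  refine key.trans (ENNReal.ofReal_le_ofReal ?_)
  have h1 : 0 ≤ D * (R ^ s * (volume.real E * volume.real F)) := by positivity
  have h2 : 0 ≤ C * (R ^ (-(1 / 2) : ℝ) * (√(volume.real E) * √(volume.real F))) := by positivity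
  linarith

end Restricted

/-! ### Estimates of restricted type -/

section RestrictedType

variable {V : Type*} [AddCommGroup V] [MeasureSpace V]

/-- The bilinear estimate `⟨μ ∗ 1_E, 1_F⟩ ≤ C |E|^α |F|^β` for sets of finite measure. -/
def RestrictedType (μ : Measure V) (α β : ℝ) : Prop :=
  ∃ C : ℝ≥0, ∀ E F : Set V, MeasurableSet E → MeasurableSet F → volume E ≠ ∞ → volume F ≠ ∞ →
    convMass μ E F ≤ C * (volume E ^ α * volume F ^ β)

theorem restrictedType_zero_one [MeasurableSub₂ V] (μ : Measure V) [IsFiniteMeasure μ] :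
    RestrictedType μ 0 1 := by
  refine ⟨(μ Set.univ).toNNReal, fun E F hE hF _ _ => ?_⟩
  rw [ENNReal.coe_toNNReal (measure_ne_top _ _), ENNReal.rpow_zero, one_mul, ENNReal.rpow_one]
  exact convMass_le_right μ hE hF

theorem restrictedType_one_zero [MeasurableSub₂ V] [MeasurableAdd V] [SFinite (volume : Measure V)]
    [(volume : Measure V).IsAddRightInvariant] (μ : Measure V) [IsFiniteMeasure μ] :
    RestrictedType μ 1 0 := by
  refine ⟨(μ Set.univ).toNNReal, fun E F hE hF _ _ => ?_⟩
  rw [ENNReal.coe_toNNReal (measure_ne_top _ _), ENNReal.rpow_zero, mul_one, ENNReal.rpow_one]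
  exact convMass_le_left μ hE hF

theorem RestrictedType.interpolate {μ : Measure V} {α₁ β₁ α₂ β₂ s t : ℝ}
    (h₁ : RestrictedType μ α₁ β₁) (h₂ : RestrictedType μ α₂ β₂) (hα₁ : 0 ≤ α₁) (hβ₁ : 0 ≤ β₁)
    (hα₂ : 0 ≤ α₂) (hβ₂ : 0 ≤ β₂) (hs : 0 ≤ s) (ht : 0 ≤ t) (hst : s + t = 1) :
    RestrictedType μ (s * α₁ + t * α₂) (s * β₁ + t * β₂) := by
  obtain ⟨C₁, h₁⟩ := h₁
  obtain ⟨C₂, h₂⟩ := h₂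
  refine ⟨C₁ ^ s * C₂ ^ t, fun E F hE hF hEv hFv => ?_⟩
  have e1 : convMass μ E F = convMass μ E F ^ s * convMass μ E F ^ t := by
    rw [← ENNReal.rpow_add_of_nonneg _ _ hs ht, hst, ENNReal.rpow_one]
  rw [e1]
  refine (mul_le_mul' (ENNReal.rpow_le_rpow (h₁ E F hE hF hEv hFv) hs)
    (ENNReal.rpow_le_rpow (h₂ E F hE hF hEv hFv) ht)).trans_eq ?_
  rw [ENNReal.mul_rpow_of_nonneg _ _ hs, ENNReal.mul_rpow_of_nonneg _ _ hs,
    ENNReal.mul_rpow_of_nonneg _ _ ht, ENNReal.mul_rpow_of_nonneg _ _ ht,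
    ENNReal.rpow_add_of_nonneg _ _ (by positivity) (by positivity),
    ENNReal.rpow_add_of_nonneg _ _ (by positivity) (by positivity),
    mul_comm s α₁, mul_comm t α₂, mul_comm s β₁, mul_comm t β₂,
    ENNReal.rpow_mul, ENNReal.rpow_mul, ENNReal.rpow_mul, ENNReal.rpow_mul, ENNReal.coe_mul,
    ENNReal.coe_rpow_of_nonneg _ hs, ENNReal.coe_rpow_of_nonneg _ ht]
  ring

instance (k l : ℕ) : (volume : Measure (Space k l)).IsAddHaarMeasure := by
  rw [Measure.volume_eq_prod]
  infer_instance

/-- The restricted estimate on the line of duality. The exponent tends to `(k + l) / (k + 2 l)`, the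
abscissa of the third vertex of the triangle, as `s` decreases to `l / k`. It results from the bound
`R ^ s |E| |F| + R ^ (-1/2) (|E| |F|) ^ (1/2)` by choosing the frequency threshold `R`. -/
theorem restrictedType_surfaceMeasure {k l : ℕ} (hl : 1 ≤ l) (hlk : l ≤ k)
    {c : Matrix (Fin k) (Fin l) ℝ} (hc : ConditionStar c) {s : ℝ} (hs : (l : ℝ) / k < s) :
    RestrictedType (surfaceMeasure (Metric.ball 0 1) (quadForm c))
      ((s + 1) / (2 * s + 1)) ((s + 1) / (2 * s + 1)) := by
  obtain ⟨C, hC0, hC⟩ := exists_convMass_gaussSurface_le hl hlk hc hs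
  have hs0 : 0 < s := lt_of_le_of_lt (by positivity) hs
  refine ⟨(Real.exp 1 * (C * 2)).toNNReal, fun E F hE hF hEv hFv => ?_⟩
  set θ := (s + 1) / (2 * s + 1) with hθ
  have hθ0 : 0 < θ := by positivity
  rcases eq_or_ne (volume E) 0 with hE0 | hE0
  · refine (convMass_le_left _ hE hF).trans ?_
    simp [hE0]
  rcases eq_or_ne (volume F) 0 with hF0 | hF0
  · refine (convMass_le_right _ hE hF).trans ?_
    simp [hF0]
  have ha : 0 < volume.real E := ENNReal.toReal_pos hE0 hEv
  have hb : 0 < volume.real F := ENNReal.toReal_pos hF0 hFv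
  set m := volume.real E * volume.real F with hm
  have hm0 : 0 < m := by positivity
  -- the choice of `R` that makes both terms equal to `m ^ θ`
  have key := hC (m ^ (-1 / (2 * s + 1))) (by positivity) E F hE hF hEv hFv
  have e1 : (m ^ (-1 / (2 * s + 1))) ^ s * m = m ^ θ := by
    nth_rw 2 [← Real.rpow_one m]
    rw [← Real.rpow_mul hm0.le, ← Real.rpow_add hm0]
    congr 1
    rw [hθ]; field_simp; ring
  have e2 : (m ^ (-1 / (2 * s + 1))) ^ (-(1 / 2) : ℝ) * (√(volume.real E) * √(volume.real F)) =
      m ^ θ := by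
    rw [← Real.sqrt_mul ha.le, ← hm, Real.sqrt_eq_rpow, ← Real.rpow_mul hm0.le,
      ← Real.rpow_add hm0]
    congr 1
    rw [hθ]; field_simp; ring
  rw [e1, e2, ← two_mul, ← mul_assoc] at key
  refine (convMass_surfaceMeasure_le c hE hF).trans ((mul_le_mul_right key _).trans_eq ?_)
  rw [← ENNReal.ofReal_mul (by positivity), ← mul_assoc, ENNReal.ofReal_mul (by positivity),
    hm, Real.mul_rpow ha.le hb.le, ENNReal.ofReal_mul (p := volume.real E ^ θ) (by positivity),
    ← ENNReal.ofReal_rpow_of_pos ha, ← ENNReal.ofReal_rpow_of_pos hb, measureReal_def,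
    measureReal_def, ENNReal.ofReal_toReal hEv, ENNReal.ofReal_toReal hFv]
  rfl

end RestrictedType

/-! ### From restricted type to strong type -/

section StrongType

theorem lintegral_Ioc_rpow_add_lintegral_Ioi_rpow {a q b : ℝ} (haq : a < q) (hqb : q < b) :
    (∫⁻ t in Set.Ioc (0 : ℝ) 1, ENNReal.ofReal (t ^ (-a)) * ENNReal.ofReal (t ^ (q - 1))) +
      ∫⁻ t in Set.Ioi (1 : ℝ), ENNReal.ofReal (t ^ (-b)) * ENNReal.ofReal (t ^ (q - 1)) =
    ENNReal.ofReal (1 / (q - a) + 1 / (b - q)) := by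
  have e1 : ∫⁻ t in Set.Ioc (0 : ℝ) 1, ENNReal.ofReal (t ^ (-a)) * ENNReal.ofReal (t ^ (q - 1)) =
      ENNReal.ofReal (1 / (q - a)) := by
    have hi : IntegrableOn (fun t : ℝ => t ^ (q - a - 1)) (Set.Ioc 0 1) :=
      (intervalIntegrable_iff_integrableOn_Ioc_of_le zero_le_one).1
        (intervalIntegral.intervalIntegrable_rpow' (by linarith))
    have h1 : ∫ t in Set.Ioc (0 : ℝ) 1, t ^ (q - a - 1) = 1 / (q - a) := by
      rw [← intervalIntegral.integral_of_le zero_le_one, integral_rpow (Or.inl (by linarith)),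
        sub_add_cancel, Real.one_rpow, Real.zero_rpow (by linarith), sub_zero]
    rw [← h1, ofReal_integral_eq_lintegral_ofReal hi]
    · refine setLIntegral_congr_fun measurableSet_Ioc fun t ht => ?_
      rw [← ENNReal.ofReal_mul (Real.rpow_nonneg ht.1.le _), ← Real.rpow_add ht.1]
      congr 2; ring
    · exact (ae_restrict_mem measurableSet_Ioc).mono fun t ht => Real.rpow_nonneg ht.1.le _
  have e2 : ∫⁻ t in Set.Ioi (1 : ℝ), ENNReal.ofReal (t ^ (-b)) * ENNReal.ofReal (t ^ (q - 1)) =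
      ENNReal.ofReal (1 / (b - q)) := by
    have hi : IntegrableOn (fun t : ℝ => t ^ (q - b - 1)) (Set.Ioi 1) :=
      integrableOn_Ioi_rpow_of_lt (by linarith) zero_lt_one
    have h1 : ∫ t in Set.Ioi (1 : ℝ), t ^ (q - b - 1) = 1 / (b - q) := by
      rw [integral_Ioi_rpow_of_lt (by linarith) zero_lt_one, sub_add_cancel, Real.one_rpow,
        ← neg_sub b q, neg_div_neg_eq]
    rw [← h1, ofReal_integral_eq_lintegral_ofReal hi]
    · refine setLIntegral_congr_fun measurableSet_Ioi fun t ht => ?_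
      have ht0 : 0 < t := zero_lt_one.trans ht
      rw [← ENNReal.ofReal_mul (Real.rpow_nonneg ht0.le _), ← Real.rpow_add ht0]
      congr 2; ring
    · exact (ae_restrict_mem measurableSet_Ioi).mono fun t ht =>
        Real.rpow_nonneg (zero_lt_one.trans ht).le _
  rw [e1, e2, ENNReal.ofReal_add (by simpa using haq.le) (by simpa using hqb.le)]

/-- Two weak-type bounds, at exponents on either side of `q`, give a strong-type bound at `q`. -/
theorem lintegral_rpow_le_of_weak {Ω : Type*} [MeasurableSpace Ω] {ν : Measure Ω} {h : Ω → ℝ≥0∞}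
    (hh : Measurable h) {a q b : ℝ} (hq : 0 < q) (haq : a < q) (hqb : q < b)
    {C : ℝ≥0∞} (hC : C ≠ ∞)
    (h1 : ∀ t : ℝ, 0 < t → ν {x | ENNReal.ofReal t < h x} ≤ C * ENNReal.ofReal (t ^ (-a)))
    (h2 : ∀ t : ℝ, 0 < t → ν {x | ENNReal.ofReal t < h x} ≤ C * ENNReal.ofReal (t ^ (-b))) :
    ∫⁻ x, h x ^ q ∂ν ≤ C * ENNReal.ofReal (q * (1 / (q - a) + 1 / (b - q))) := by
  have hfin : ∀ᵐ x ∂ν, h x ≠ ∞ := by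
    rw [ae_iff]
    have ht : Filter.Tendsto (fun t : ℝ => C * ENNReal.ofReal (t ^ (-b))) Filter.atTop
        (nhds (C * ENNReal.ofReal 0)) :=
      ENNReal.Tendsto.const_mul ((ENNReal.continuous_ofReal.tendsto 0).comp
        (tendsto_rpow_neg_atTop (hq.trans hqb))) (Or.inr hC)
    rw [ENNReal.ofReal_zero, mul_zero] at ht
    refine le_antisymm (ge_of_tendsto ht ?_) zero_le
    filter_upwards [Filter.eventually_gt_atTop 0] with t ht0
    refine (measure_mono fun x hx => ?_).trans (h2 t ht0)
    have : h x = ∞ := by simpa using hx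
    simp [this]
  have e1 : ∫⁻ x, h x ^ q ∂ν = ∫⁻ x, ENNReal.ofReal ((h x).toReal ^ q) ∂ν := by
    refine lintegral_congr_ae (hfin.mono fun x hx => ?_)
    simp only
    rw [← ENNReal.ofReal_rpow_of_nonneg ENNReal.toReal_nonneg hq.le, ENNReal.ofReal_toReal hx]
  rw [e1, lintegral_rpow_eq_lintegral_meas_lt_mul ν
    (Filter.Eventually.of_forall fun x => ENNReal.toReal_nonneg) hh.ennreal_toReal.aemeasurable hq,
    ← Set.Ioc_union_Ioi_eq_Ioi zero_le_one,
    lintegral_union measurableSet_Ioi (Set.Ioc_disjoint_Ioi le_rfl)]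
  have hsub : ∀ t : ℝ, 0 < t → ν {x | t < (h x).toReal} ≤ ν {x | ENNReal.ofReal t < h x} :=
    fun t ht => measure_mono fun x hx => by
      have hx' : t < (h x).toReal := hx
      refine (ENNReal.ofReal_lt_iff_lt_toReal ht.le ?_).2 hx'
      rintro he
      rw [he] at hx'
      simp at hx'
      linarith
  have b1 : ∫⁻ t in Set.Ioc (0 : ℝ) 1, ν {x | t < (h x).toReal} * ENNReal.ofReal (t ^ (q - 1)) ≤
      C * ∫⁻ t in Set.Ioc (0 : ℝ) 1, ENNReal.ofReal (t ^ (-a)) * ENNReal.ofReal (t ^ (q - 1)) := by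
    rw [← lintegral_const_mul' _ _ hC]
    refine setLIntegral_mono' measurableSet_Ioc fun t ht => ?_
    rw [← mul_assoc]
    exact mul_le_mul_left ((hsub t ht.1).trans (h1 t ht.1)) _
  have b2 : ∫⁻ t in Set.Ioi (1 : ℝ), ν {x | t < (h x).toReal} * ENNReal.ofReal (t ^ (q - 1)) ≤
      C * ∫⁻ t in Set.Ioi (1 : ℝ), ENNReal.ofReal (t ^ (-b)) * ENNReal.ofReal (t ^ (q - 1)) := by
    rw [← lintegral_const_mul' _ _ hC]
    refine setLIntegral_mono' measurableSet_Ioi fun t ht => ?_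
    have ht0 : 0 < t := zero_lt_one.trans ht
    rw [← mul_assoc]
    exact mul_le_mul_left ((hsub t ht0).trans (h2 t ht0)) _
  refine (mul_le_mul_right (add_le_add b1 b2) _).trans_eq ?_
  rw [← mul_add, lintegral_Ioc_rpow_add_lintegral_Ioi_rpow haq hqb, ENNReal.ofReal_mul hq.le]
  ring

end StrongType

section Strong

variable {V : Type*} [AddCommGroup V] [MeasureSpace V] [MeasurableSub₂ V]

theorem measurable_lintegral_sub (μ : Measure V) [SFinite μ] {f : V → ℝ≥0∞} (hf : Measurable f) :
    Measurable fun z => ∫⁻ x, f (z - x) ∂μ :=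
  (hf.comp measurable_sub).lintegral_prod_right'

/-- Summing the restricted estimates over the level sets of `f`. -/
theorem exists_setLIntegral_conv_le {μ : Measure V} [SFinite μ] {p δ β : ℝ} (hp : 0 < p)
    (hδ : 0 < δ) (hδp : δ < 1 / p) (hβ : 0 ≤ β) (h1 : RestrictedType μ (1 / p - δ) β)
    (h2 : RestrictedType μ (1 / p + δ) β) :
    ∃ C : ℝ≥0, ∀ f : V → ℝ≥0∞, Measurable f → ∫⁻ x, f x ^ p ≤ 1 → ∀ F : Set V, MeasurableSet F →
      volume F ≠ ∞ → ∫⁻ z in F, ∫⁻ x, f (z - x) ∂μ ≤ C * volume F ^ β := by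
  obtain ⟨C₁, h1⟩ := h1
  obtain ⟨C₂, h2⟩ := h2
  set B : ℝ := 1 * (1 / (1 - (1 - p * δ)) + 1 / (1 + p * δ - 1)) with hB
  refine ⟨max C₁ C₂ * B.toNNReal, fun f hf hf1 F hF hFv => ?_⟩
  set ν := (((volume : Measure V).restrict F).prod μ).map fun z => z.1 - z.2 with hν
  have e1 : ∫⁻ z in F, ∫⁻ x, f (z - x) ∂μ = ∫⁻ x, f x ^ (1 : ℝ) ∂ν := by
    simp_rw [ENNReal.rpow_one]
    have hfs : Measurable fun z : V × V => f (z.1 - z.2) := hf.comp measurable_sub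
    rw [hν, lintegral_map hf measurable_sub, lintegral_prod _ hfs.aemeasurable]
  have hlev : ∀ t : ℝ, 0 < t → volume {x | ENNReal.ofReal t < f x} ≤ ENNReal.ofReal (t ^ (-p)) := by
    intro t ht
    have htp : 0 < t ^ p := by positivity
    calc volume {x | ENNReal.ofReal t < f x} ≤ volume {x | ENNReal.ofReal t ^ p ≤ f x ^ p} :=
          measure_mono fun x hx => ENNReal.rpow_le_rpow (le_of_lt hx) hp.le
      _ ≤ (∫⁻ x, f x ^ p) / ENNReal.ofReal t ^ p :=
          meas_ge_le_lintegral_div (hf.pow_const p).aemeasurable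
            (by simp [ENNReal.rpow_eq_zero_iff, ht])
            (ENNReal.rpow_ne_top_of_nonneg hp.le ENNReal.ofReal_ne_top)
      _ ≤ 1 / ENNReal.ofReal t ^ p := ENNReal.div_le_div_right hf1 _
      _ = _ := by
          rw [ENNReal.ofReal_rpow_of_pos ht, one_div, ← ENNReal.ofReal_inv_of_pos htp,
            Real.rpow_neg ht.le]
  have hm : ∀ t : ℝ, MeasurableSet {x | ENNReal.ofReal t < f x} :=
    fun t => measurableSet_lt measurable_const hf
  have hweak : ∀ (a : ℝ) (C : ℝ≥0), 0 < a → C ≤ max C₁ C₂ →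
      (∀ E F : Set V, MeasurableSet E → MeasurableSet F → volume E ≠ ∞ → volume F ≠ ∞ →
        convMass μ E F ≤ C * (volume E ^ a * volume F ^ β)) → ∀ t : ℝ, 0 < t →
      ν {x | ENNReal.ofReal t < f x} ≤
        ((max C₁ C₂ : ℝ≥0) * volume F ^ β) * ENNReal.ofReal (t ^ (-(p * a))) := by
    intro a C ha hC h t ht
    rw [hν, ← convMass_eq_map_left μ (hm t) hF]
    refine (h _ F (hm t) hF ((hlev t ht).trans_lt ENNReal.ofReal_lt_top).ne hFv).trans ?_
    have h3 : volume {x | ENNReal.ofReal t < f x} ^ a ≤ ENNReal.ofReal (t ^ (-(p * a))) := by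
      refine (ENNReal.rpow_le_rpow (hlev t ht) ha.le).trans_eq ?_
      rw [ENNReal.ofReal_rpow_of_pos (by positivity), ← Real.rpow_mul ht.le, neg_mul]
    rw [mul_comm (volume _ ^ a), ← mul_assoc]
    gcongr
  have hpδ : 0 < p * δ := by positivity
  have ea : p * (1 / p - δ) = 1 - p * δ := by field_simp
  have eb : p * (1 / p + δ) = 1 + p * δ := by field_simp
  have key := lintegral_rpow_le_of_weak (ν := ν) hf (a := 1 - p * δ) (q := 1) (b := 1 + p * δ)
    (C := (max C₁ C₂ : ℝ≥0) * volume F ^ β) one_pos (by linarith) (by linarith)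
    (ENNReal.mul_ne_top ENNReal.coe_ne_top (ENNReal.rpow_ne_top_of_nonneg hβ hFv))
    (ea ▸ hweak _ C₁ (by linarith) (le_max_left _ _) h1)
    (eb ▸ hweak _ C₂ (by positivity) (le_max_right _ _) h2)
  rw [e1]
  refine key.trans_eq ?_
  rw [← hB, ENNReal.coe_mul, mul_right_comm]
  rfl

omit [AddCommGroup V] [MeasurableSub₂ V] in
/-- Testing against subsets of a level set turns integral bounds into a weak-type bound. -/
theorem volume_lt_le_of_setLIntegral_le [SigmaFinite (volume : Measure V)] {h : V → ℝ≥0∞}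
    (hh : Measurable h) {C : ℝ≥0∞} {b : ℝ} (hb : 0 < b)
    (H : ∀ F : Set V, MeasurableSet F → volume F ≠ ∞ → ∫⁻ z in F, h z ≤ C * volume F ^ (1 - b))
    {t : ℝ} (ht : 0 < t) :
    volume {x | ENNReal.ofReal t < h x} ≤ C ^ (1 / b) * ENNReal.ofReal (t ^ (-(1 / b))) := by
  refine le_of_forall_lt fun r hr => ?_
  obtain ⟨F, hF, hFs, hrF, hFv⟩ :=
    Measure.exists_subset_measure_lt_top (measurableSet_lt measurable_const hh) hr
  refine hrF.trans_le ?_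
  have hF0 : volume F ≠ 0 := (hrF.trans_le' zero_le).ne'
  have h1 : ENNReal.ofReal t * volume F ≤ C * volume F ^ (1 - b) := by
    rw [← setLIntegral_const]
    exact (setLIntegral_mono' hF fun x hx => le_of_lt (hFs hx)).trans (H F hF hFv.ne)
  have h2 : volume F ^ b ≤ C * ENNReal.ofReal (t⁻¹) := by
    have e : volume F = volume F ^ b * volume F ^ (1 - b) := by
      rw [← ENNReal.rpow_add _ _ hF0 hFv.ne]; simp
    have hne : volume F ^ (1 - b) ≠ 0 := by
      simp [ENNReal.rpow_eq_zero_iff, hF0, hFv.ne]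
    have hnt : volume F ^ (1 - b) ≠ ∞ := by
      simp [ENNReal.rpow_eq_top_iff, hF0, hFv.ne]
    nth_rw 1 [e] at h1
    rw [← mul_assoc, ENNReal.mul_le_mul_iff_left hne hnt] at h1
    rw [ENNReal.ofReal_inv_of_pos ht, ← div_eq_mul_inv, ENNReal.le_div_iff_mul_le (by simp [ht])
      (by simp), mul_comm]
    exact h1
  have h3 := ENNReal.rpow_le_rpow h2 (one_div_pos.2 hb).le
  rw [← ENNReal.rpow_mul, mul_one_div_cancel hb.ne', ENNReal.rpow_one,
    ENNReal.mul_rpow_of_nonneg _ _ (one_div_pos.2 hb).le,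
    ENNReal.ofReal_rpow_of_pos (inv_pos.2 ht), Real.inv_rpow ht.le, ← Real.rpow_neg ht.le] at h3
  exact h3

/-- Restricted estimates at the four corners of a square around `(1 / p, 1 - 1 / q)` give the
strong estimate at the centre. -/
theorem exists_lintegral_conv_rpow_le [SigmaFinite (volume : Measure V)] {μ : Measure V} [SFinite μ]
    {p q δ : ℝ} (hp : 0 < p) (hq : 0 < q) (hδ : 0 < δ) (hδp : δ < 1 / p) (hδq : δ < 1 / q)
    (hδq' : 1 / q + δ ≤ 1)
    (H : ∀ ε₁ ∈ ({δ, -δ} : Set ℝ), ∀ ε₂ ∈ ({δ, -δ} : Set ℝ),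
      RestrictedType μ (1 / p + ε₁) (1 - (1 / q + ε₂))) :
    ∃ C : ℝ≥0, ∀ f : V → ℝ≥0∞, Measurable f → ∫⁻ x, f x ^ p ≤ 1 →
      ∫⁻ z, (∫⁻ x, f (z - x) ∂μ) ^ q ≤ C := by
  obtain ⟨C₁, h1⟩ := exists_setLIntegral_conv_le (μ := μ) (β := 1 - (1 / q + δ)) hp hδ hδp
    (by linarith) (by simpa [sub_eq_add_neg] using H (-δ) (by simp) δ (by simp))
    (H δ (by simp) δ (by simp))
  obtain ⟨C₂, h2⟩ := exists_setLIntegral_conv_le (μ := μ) (β := 1 - (1 / q - δ)) hp hδ hδp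
    (by linarith) (by simpa [sub_eq_add_neg] using H (-δ) (by simp) (-δ) (by simp))
    (by simpa [sub_eq_add_neg] using H δ (by simp) (-δ) (by simp))
  set b₁ := 1 / q + δ with hb₁
  set b₂ := 1 / q - δ with hb₂
  have hb₁0 : 0 < b₁ := by positivity
  have hb₂0 : 0 < b₂ := by linarith
  set M : ℝ≥0 := max (C₁ ^ (1 / b₁)) (C₂ ^ (1 / b₂)) with hM
  set B : ℝ := q * (1 / (q - 1 / b₁) + 1 / (1 / b₂ - q)) with hB
  refine ⟨M * B.toNNReal, fun f hf hf1 => ?_⟩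
  have hTf := measurable_lintegral_sub μ hf
  have hqq : 1 / (1 / q) = q := by simp
  have ha : 1 / b₁ < q := by
    rw [← hqq]; exact one_div_lt_one_div_of_lt (by positivity) (by linarith)
  have hb : q < 1 / b₂ := by
    nth_rw 1 [← hqq]; exact one_div_lt_one_div_of_lt hb₂0 (by linarith)
  have hM1 : (C₁ : ℝ≥0∞) ^ (1 / b₁) ≤ M := by
    rw [← ENNReal.coe_rpow_of_nonneg _ (by positivity)]
    exact ENNReal.coe_le_coe.2 (le_max_left _ _)
  have hM2 : (C₂ : ℝ≥0∞) ^ (1 / b₂) ≤ M := by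
    rw [← ENNReal.coe_rpow_of_nonneg _ (by positivity)]
    exact ENNReal.coe_le_coe.2 (le_max_right _ _)
  refine (lintegral_rpow_le_of_weak (C := M) hTf hq ha hb ENNReal.coe_ne_top
    (fun t ht => ?_) (fun t ht => ?_)).trans_eq ?_
  · exact (volume_lt_le_of_setLIntegral_le hTf hb₁0 (h1 f hf hf1) ht).trans
      (mul_le_mul_left hM1 _)
  · exact (volume_lt_le_of_setLIntegral_le hTf hb₂0 (h2 f hf hf1) ht).trans
      (mul_le_mul_left hM2 _)
  · rw [ENNReal.coe_mul]; rfl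

omit [MeasurableSub₂ V] in
/-- Removing the normalisation by homogeneity. Dividing by `‖f‖_p + ε` avoids a separate treatment
of functions that vanish almost everywhere. -/
theorem exists_conv_norm_le {μ : Measure V} [SFinite μ] {p q : ℝ} (hp : 0 < p) (hq : 0 < q)
    {C : ℝ≥0} (H : ∀ f : V → ℝ≥0∞, Measurable f → ∫⁻ x, f x ^ p ≤ 1 →
      ∫⁻ z, (∫⁻ x, f (z - x) ∂μ) ^ q ≤ C) {f : V → ℝ≥0∞} (hf : Measurable f)
      (hfp : ∫⁻ x, f x ^ p ≠ ∞) :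
    (∫⁻ z, (∫⁻ x, f (z - x) ∂μ) ^ q) ^ (1 / q) ≤
      (C ^ (1 / q) : ℝ≥0) * (∫⁻ x, f x ^ p) ^ (1 / p) := by
  set N := (∫⁻ x, f x ^ p) ^ (1 / p) with hN
  have hNt : N ≠ ∞ := ENNReal.rpow_ne_top_of_nonneg (by positivity) hfp
  have hNp : N ^ p = ∫⁻ x, f x ^ p := by
    rw [hN, ← ENNReal.rpow_mul, one_div_mul_cancel hp.ne', ENNReal.rpow_one]
  have key : ∀ ε : ℝ, 0 < ε → (∫⁻ z, (∫⁻ x, f (z - x) ∂μ) ^ q) ^ (1 / q) ≤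
      (C ^ (1 / q) : ℝ≥0) * (N + ENNReal.ofReal ε) := by
    intro ε hε
    set c := N + ENNReal.ofReal ε with hc
    have hc0 : c ≠ 0 := by simp [hc, hε]
    have hct : c ≠ ∞ := ENNReal.add_ne_top.2 ⟨hNt, ENNReal.ofReal_ne_top⟩
    have hci : c⁻¹ ≠ ∞ := ENNReal.inv_ne_top.2 hc0
    have h1 : ∫⁻ x, (c⁻¹ * f x) ^ p ≤ 1 := by
      simp_rw [ENNReal.mul_rpow_of_nonneg _ _ hp.le]
      rw [lintegral_const_mul' _ _ (ENNReal.rpow_ne_top_of_nonneg hp.le hci), ← hNp,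
        ← ENNReal.mul_rpow_of_nonneg _ _ hp.le]
      refine ENNReal.rpow_le_one ?_ hp.le
      calc c⁻¹ * N ≤ c⁻¹ * c := mul_le_mul_right le_self_add _
        _ = 1 := ENNReal.inv_mul_cancel hc0 hct
    have h2 := H _ (hf.const_mul c⁻¹) h1
    simp_rw [lintegral_const_mul' _ _ hci, ENNReal.mul_rpow_of_nonneg _ _ hq.le] at h2
    rw [lintegral_const_mul' _ _ (ENNReal.rpow_ne_top_of_nonneg hq.le hci)] at h2
    have h3 := ENNReal.rpow_le_rpow h2 (one_div_pos.2 hq).le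
    rw [ENNReal.mul_rpow_of_nonneg _ _ (one_div_pos.2 hq).le, ← ENNReal.rpow_mul,
      mul_one_div_cancel hq.ne', ENNReal.rpow_one,
      ← ENNReal.coe_rpow_of_nonneg _ (one_div_pos.2 hq).le] at h3
    rw [mul_comm _ c]
    calc _ = c * (c⁻¹ * (∫⁻ z, (∫⁻ x, f (z - x) ∂μ) ^ q) ^ (1 / q)) := by
          rw [← mul_assoc, ENNReal.mul_inv_cancel hc0 hct, one_mul]
      _ ≤ _ := mul_le_mul_right h3 _
  have ht : Filter.Tendsto (fun ε : ℝ => ((C ^ (1 / q) : ℝ≥0) : ℝ≥0∞) * (N + ENNReal.ofReal ε))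
      (nhdsWithin 0 (Set.Ioi 0)) (nhds ((C ^ (1 / q) : ℝ≥0) * (N + ENNReal.ofReal 0))) := by
    refine Filter.Tendsto.mono_left ?_ nhdsWithin_le_nhds
    refine ENNReal.Tendsto.const_mul (Filter.Tendsto.add tendsto_const_nhds ?_)
      (Or.inr ENNReal.coe_ne_top)
    exact ENNReal.continuous_ofReal.tendsto 0
  rw [ENNReal.ofReal_zero, add_zero] at ht
  exact ge_of_tendsto ht (eventually_mem_nhdsWithin.mono fun ε hε => key ε hε)

end Strong

section Estimate

variable {k l : ℕ}

/-- A property that holds almost everywhere holds along almost every translate of `-μ`, even though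
`μ` may be singular. This makes `μ ∗ f` independent of the representative of `f`. -/
theorem ae_ae_sub_of_ae (μ : Measure (Space k l)) [IsFiniteMeasure μ]
    {P : Space k l → Prop} (h : ∀ᵐ x, P x) : ∀ᵐ z, ∀ᵐ x ∂μ, P (z - x) := by
  obtain ⟨N, hN, hNm, hN0⟩ := exists_measurable_superset_of_null h
  have h0 : convMass μ N Set.univ = 0 := by
    refine le_antisymm ((convMass_le_left μ hNm MeasurableSet.univ).trans ?_) zero_le
    simp [hN0]
  have hmz : Measurable fun z => μ {u | z - u ∈ N} :=
    measurable_measure_prodMk_left (measurable_sub hNm)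
  rw [convMass_eq_lintegral_right μ hNm MeasurableSet.univ, setLIntegral_univ,
    lintegral_eq_zero_iff hmz] at h0
  filter_upwards [h0] with z hz
  refine measure_mono_null (fun x hx => ?_) hz
  exact hN hx

/-- The strong estimate for nonnegative functions implies the estimate for complex functions, with
the accompanying convergence and measurability. -/
theorem convolutionEstimate_of_lintegral (μ : Measure (Space k l)) [IsFiniteMeasure μ] {p q : ℝ}
    (hp : 0 < p) (hq : 0 < q) {C : ℝ≥0} (H : ∀ f : Space k l → ℝ≥0∞, Measurable f →
      ∫⁻ x, f x ^ p ≠ ∞ → (∫⁻ z, (∫⁻ x, f (z - x) ∂μ) ^ q) ^ (1 / q) ≤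
        C * (∫⁻ x, f x ^ p) ^ (1 / p)) :
    ConvolutionEstimate μ (ENNReal.ofReal p) (ENNReal.ofReal q) := by
  have hp0 : ENNReal.ofReal p ≠ 0 := by simpa using hp
  have hq0 : ENNReal.ofReal q ≠ 0 := by simpa using hq
  refine ⟨C, fun f hf => ?_⟩
  obtain ⟨g, hg, hfg⟩ := hf.1
  have hconv := ae_ae_sub_of_ae μ hfg
  have hgp : ∫⁻ x, ‖g x‖ₑ ^ p ≠ ∞ := by
    have h1 := hf.2
    rw [eLpNorm_congr_ae hfg, eLpNorm_lt_top_iff_lintegral_rpow_enorm_lt_top hp0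
      ENNReal.ofReal_ne_top, ENNReal.toReal_ofReal hp.le] at h1
    exact h1.ne
  have hT := H (fun x => ‖g x‖ₑ) hg.measurable.enorm hgp
  have hTm := measurable_lintegral_sub μ hg.measurable.enorm
  have hfin : ∀ᵐ z, ∫⁻ x, ‖g (z - x)‖ₑ ∂μ < ∞ := by
    have h1 : ∫⁻ z, (∫⁻ x, ‖g (z - x)‖ₑ ∂μ) ^ q ≠ ∞ := by
      have : (∫⁻ z, (∫⁻ x, ‖g (z - x)‖ₑ ∂μ) ^ q) ^ (1 / q) < ∞ := hT.trans_lt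
        (ENNReal.mul_lt_top ENNReal.coe_lt_top (ENNReal.rpow_lt_top_of_nonneg (by positivity) hgp))
      exact ((ENNReal.rpow_lt_top_iff_of_pos (by positivity)).1 this).ne
    filter_upwards [ae_lt_top (hTm.pow_const q) h1] with z hz
    exact (ENNReal.rpow_lt_top_iff_of_pos hq).1 hz
  have hcongr : measureConv μ f =ᵐ[volume] measureConv μ g := by
    filter_upwards [hconv] with z hz
    exact integral_congr_ae hz
  refine ⟨?_, ?_, ?_⟩
  · filter_upwards [hconv, hfin] with z hz hz2
    refine Integrable.congr ⟨?_, hz2⟩ (Filter.EventuallyEq.symm hz)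
    exact (hg.comp_measurable (measurable_id.const_sub z)).aestronglyMeasurable
  · refine AEStronglyMeasurable.congr ?_ hcongr.symm
    exact (hg.comp_measurable measurable_sub).integral_prod_right'.aestronglyMeasurable
  · rw [eLpNorm_congr_ae hcongr, eLpNorm_congr_ae hfg,
      eLpNorm_eq_lintegral_rpow_enorm_toReal hq0 ENNReal.ofReal_ne_top,
      eLpNorm_eq_lintegral_rpow_enorm_toReal hp0 ENNReal.ofReal_ne_top,
      ENNReal.toReal_ofReal hp.le, ENNReal.toReal_ofReal hq.le]
    refine le_trans (ENNReal.rpow_le_rpow (lintegral_mono fun z => ?_) (by positivity)) hT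
    exact ENNReal.rpow_le_rpow (enorm_integral_le_lintegral_enorm _) hq.le

end Estimate

/-! ### The triangle -/

section Triangle

theorem mem_convexHull_triple_iff {θ : ℝ} (hθ : 1 / 2 < θ) (p : ℝ × ℝ) :
    p ∈ convexHull ℝ {((0 : ℝ), (0 : ℝ)), ((1 : ℝ), (1 : ℝ)), (θ, 1 - θ)} ↔
      p.2 ≤ p.1 ∧ p.1 ≤ θ * (p.1 + p.2) ∧ (p.1 - p.2) * (1 - θ) ≤ (1 - p.1) * (2 * θ - 1) := by
  have h2 : 0 < 2 * θ - 1 := by linarith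
  constructor
  · intro hp
    refine convexHull_min (t := {p : ℝ × ℝ | p.2 ≤ p.1 ∧ p.1 ≤ θ * (p.1 + p.2) ∧
      (p.1 - p.2) * (1 - θ) ≤ (1 - p.1) * (2 * θ - 1)}) ?_ ?_ hp
    · rintro q (rfl | rfl | rfl)
      · exact ⟨le_rfl, by simp, by simp; linarith⟩
      · exact ⟨le_rfl, by simp; linarith, by simp⟩
      · exact ⟨by simp; linarith, by simp, by simp; linarith⟩
    · rintro ⟨x, y⟩ ⟨h1, h2, h3⟩ ⟨x', y'⟩ ⟨h1', h2', h3'⟩ a b ha hb hab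
      simp only [Set.mem_ofPred_eq, Prod.smul_mk, Prod.mk_add_mk, smul_eq_mul] at *
      obtain rfl : b = 1 - a := by linarith
      refine ⟨?_, ?_, ?_⟩
      · linarith [mul_le_mul_of_nonneg_left h1 ha, mul_le_mul_of_nonneg_left h1' hb]
      · linarith [mul_le_mul_of_nonneg_left h2 ha, mul_le_mul_of_nonneg_left h2' hb]
      · linarith [mul_le_mul_of_nonneg_left h3 ha, mul_le_mul_of_nonneg_left h3' hb]
  · rintro ⟨h1, h3, h4⟩
    obtain ⟨x, y⟩ := p
    simp only at h1 h3 h4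
    -- barycentric coordinates with respect to the three vertices
    set c := (x - y) / (2 * θ - 1) with hc
    have hc' : c * (2 * θ - 1) = x - y := div_mul_cancel₀ _ h2.ne'
    have hc0 : 0 ≤ c := div_nonneg (by linarith) h2.le
    have hb0 : 0 ≤ x - c * θ := by
      have : 0 ≤ (x - c * θ) * (2 * θ - 1) := by nlinarith
      exact nonneg_of_mul_nonneg_left this h2
    have ha0 : 0 ≤ 1 - (x - c * θ) - c := by
      have : 0 ≤ (1 - (x - c * θ) - c) * (2 * θ - 1) := by nlinarith
      exact nonneg_of_mul_nonneg_left this h2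
    have := (convex_convexHull ℝ ({((0 : ℝ), (0 : ℝ)), ((1 : ℝ), (1 : ℝ)), (θ, 1 - θ)} :
      Set (ℝ × ℝ))).sum_mem (t := Finset.univ) (w := ![1 - (x - c * θ) - c, x - c * θ, c])
      (z := ![((0 : ℝ), (0 : ℝ)), ((1 : ℝ), (1 : ℝ)), (θ, 1 - θ)]) ?_ ?_ ?_
    · rw [Fin.sum_univ_three] at this
      convert this using 1
      ext
      · simp
      · simp; linarith
    · intro i _; fin_cases i <;> simp <;> linarith
    · rw [Fin.sum_univ_three]; simp; ring
    · intro i _; refine subset_convexHull ℝ _ ?_; fin_cases i <;> simp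

variable {k l : ℕ}

theorem triangle_eq (hl : 1 ≤ l) : triangle k (k + l) = convexHull ℝ {((0 : ℝ), (0 : ℝ)),
    ((1 : ℝ), (1 : ℝ)), (((k : ℝ) + l) / (k + 2 * l), 1 - ((k : ℝ) + l) / (k + 2 * l))} := by
  have hl' : (0 : ℝ) < l := by exact_mod_cast hl
  have hk' : (0 : ℝ) ≤ k := k.cast_nonneg
  have h : (k : ℝ) + 2 * l ≠ 0 := by positivity
  have e : 2 * ((k : ℝ) + l) - k = k + 2 * l := by ring
  rw [triangle]
  push_cast
  rw [e]
  have e2 : ((k : ℝ) + l - k) / (k + 2 * l) = 1 - ((k : ℝ) + l) / (k + 2 * l) := by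
    field_simp; ring
  rw [e2]

theorem half_lt_vertex (hl : 1 ≤ l) (hlk : l ≤ k) : 1 / 2 < ((k : ℝ) + l) / (k + 2 * l) := by
  have hl' : (0 : ℝ) < l := by exact_mod_cast hl
  have hk' : (0 : ℝ) < k := by exact_mod_cast hl.trans hlk
  rw [div_lt_div_iff₀ (by positivity) (by positivity)]
  linarith

theorem strict_of_mem_interior_triangle (hl : 1 ≤ l) (hlk : l ≤ k) {p : ℝ × ℝ}
    (hp : p ∈ interior (triangle k (k + l))) {θ : ℝ} (hθ : θ = ((k : ℝ) + l) / (k + 2 * l)) :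
    p.2 < p.1 ∧ p.1 < θ * (p.1 + p.2) ∧ (p.1 - p.2) * (1 - θ) < (1 - p.1) * (2 * θ - 1) := by
  have hθ2 : 1 / 2 < θ := hθ ▸ half_lt_vertex hl hlk
  have hθ1 : θ ≤ 1 := by
    rw [hθ]
    exact div_le_one_of_le₀ (by linarith [(l.cast_nonneg : (0 : ℝ) ≤ l)]) (by positivity)
  obtain ⟨ε, hε, hb⟩ := Metric.mem_nhds_iff.1 (mem_interior_iff_mem_nhds.1 hp)
  rw [triangle_eq hl, ← hθ] at hb
  have hmem : ∀ s : ℝ, |s| ≤ ε / 2 → (p.1 + s, p.2 - s) ∈ Metric.ball p ε := fun s hs => by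
    rw [Metric.mem_ball, Prod.dist_eq, max_lt_iff]
    simp only [Real.dist_eq, add_sub_cancel_left, sub_sub_cancel_left, abs_neg]
    exact ⟨by linarith, by linarith⟩
  have h1 := (mem_convexHull_triple_iff hθ2 _).1 (hb (hmem (ε / 2) (abs_of_pos (by linarith)).le))
  have h2 := (mem_convexHull_triple_iff hθ2 _).1 (hb (hmem (-(ε / 2)) (by
    rw [abs_neg]; exact (abs_of_pos (by linarith)).le)))
  simp only at h1 h2
  refine ⟨by linarith [h2.1], by nlinarith [h1.2.1], ?_⟩
  have := h1.2.2
  nlinarith [mul_nonneg hε.le (sub_nonneg.2 hθ1), mul_pos hε (sub_pos.2 hθ2)]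

end Triangle

/-! ### The estimate inside the triangle -/

section Sufficiency

variable {k l : ℕ}

theorem restrictedType_of_mem_interior (hl : 1 ≤ l) (hlk : l ≤ k) {c : Matrix (Fin k) (Fin l) ℝ}
    (hc : ConditionStar c) {p : ℝ × ℝ} (hp : p ∈ interior (triangle k (k + l))) :
    RestrictedType (surfaceMeasure (Metric.ball 0 1) (quadForm c)) p.1 (1 - p.2) := by
  have hl' : (0 : ℝ) < l := by exact_mod_cast hl
  have hk' : (0 : ℝ) < k := by exact_mod_cast hl.trans hlk
  set θ : ℝ → ℝ := fun s => (s + 1) / (2 * s + 1) with hθ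
  have hs0 : (0 : ℝ) < l / k := by positivity
  have hθ0 : θ (l / k) = ((k : ℝ) + l) / (k + 2 * l) := by
    simp only [hθ]; field_simp; ring
  obtain ⟨h1, h2, h3⟩ := strict_of_mem_interior_triangle hl hlk hp hθ0
  have hcont : ContinuousAt θ (l / k) := by
    refine ContinuousAt.div (by fun_prop) (by fun_prop) ?_
    positivity
  -- the strict inequalities persist for exponents slightly beyond the critical one
  have hev : ∀ᶠ s in nhdsWithin ((l : ℝ) / k) (Set.Ioi ((l : ℝ) / k)), 1 / 2 < θ s ∧
      p.1 < θ s * (p.1 + p.2) ∧ (p.1 - p.2) * (1 - θ s) < (1 - p.1) * (2 * θ s - 1) := by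
    refine nhdsWithin_le_nhds ?_
    have c1 : ContinuousAt (fun s => θ s * (p.1 + p.2)) (l / k) := by fun_prop
    have c2 : ContinuousAt (fun s => (p.1 - p.2) * (1 - θ s)) (l / k) := by fun_prop
    have c3 : ContinuousAt (fun s => (1 - p.1) * (2 * θ s - 1)) (l / k) := by fun_prop
    refine (hcont.eventually (lt_mem_nhds (hθ0 ▸ half_lt_vertex hl hlk))).and
      ((c1.eventually (lt_mem_nhds h2)).and (c2.eventually_lt c3 h3))
  obtain ⟨s, ⟨hs2, hs3, hs4⟩, hs⟩ := (hev.and self_mem_nhdsWithin).exists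
  have hs' : (l : ℝ) / k < s := hs
  have hspos : 0 < s := hs0.trans hs'
  have hmem := (mem_convexHull_triple_iff hs2 p).2 ⟨h1.le, hs3.le, hs4.le⟩
  have hθ1 : 0 ≤ θ s := by linarith
  refine (convexHull_min (t := {p : ℝ × ℝ | 0 ≤ p.1 ∧ 0 ≤ 1 - p.2 ∧
    RestrictedType (surfaceMeasure (Metric.ball 0 1) (quadForm c)) p.1 (1 - p.2)}) ?_ ?_ hmem).2.2
  · rintro q (rfl | rfl | rfl)
    · exact ⟨le_rfl, by simp, by simpa using restrictedType_zero_one _⟩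
    · exact ⟨zero_le_one, by simp, by simpa using restrictedType_one_zero _⟩
    · refine ⟨hθ1, by simpa using hθ1, ?_⟩
      simpa using restrictedType_surfaceMeasure hl hlk hc hs'
  · rintro x ⟨hx1, hx2, hx3⟩ y ⟨hy1, hy2, hy3⟩ a b ha hb hab
    have e : 1 - (a • x + b • y).2 = a * (1 - x.2) + b * (1 - y.2) := by
      simp; linear_combination -hab
    refine ⟨?_, ?_, ?_⟩
    · simp only [Prod.fst_add, Prod.smul_fst, smul_eq_mul]; positivity
    · rw [e]; positivity
    · rw [e]
      exact hx3.interpolate hy3 hx1 hx2 hy1 hy2 ha hb hab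

theorem ennreal_eq_ofReal_one_div {p : ℝ≥0∞} (h : 0 < (p⁻¹).toReal) :
    p = ENNReal.ofReal (1 / (p⁻¹).toReal) := by
  have h1 : p⁻¹ ≠ ∞ := fun h' => by simp [h'] at h
  rw [one_div, ENNReal.ofReal_inv_of_pos h, ENNReal.ofReal_toReal h1, inv_inv]

theorem convolutionEstimate_of_mem_interior (hl : 1 ≤ l) (hlk : l ≤ k)
    {c : Matrix (Fin k) (Fin l) ℝ} (hc : ConditionStar c) {p q : ℝ≥0∞}
    (h : expPoint p q ∈ interior (triangle k (k + l))) :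
    ConvolutionEstimate (surfaceMeasure (Metric.ball 0 1) (quadForm c)) p q := by
  set x := (p⁻¹).toReal with hx
  set y := (q⁻¹).toReal with hy
  have hxy : (x, y) ∈ interior (triangle k (k + l)) := h
  -- a square around `(x, y)` inside the interior of the triangle
  obtain ⟨ε, hε, hb⟩ := Metric.isOpen_iff.1 isOpen_interior _ hxy
  set δ := ε / 2 with hδ
  have hδ0 : 0 < δ := by positivity
  have hmem : ∀ s t : ℝ, |s| ≤ δ → |t| ≤ δ → (x + s, y + t) ∈ interior (triangle k (k + l)) :=
    fun s t hs ht => hb (by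
      rw [Metric.mem_ball, Prod.dist_eq, max_lt_iff]
      simp only [Real.dist_eq, add_sub_cancel_left]
      exact ⟨by linarith, by linarith⟩)
  have hδa : |δ| ≤ δ := (abs_of_pos hδ0).le
  have hδn : |-δ| ≤ δ := by rwa [abs_neg]
  have hv := half_lt_vertex hl hlk
  have hv1 : ((k : ℝ) + l) / (k + 2 * l) ≤ 1 :=
    div_le_one_of_le₀ (by linarith [(l.cast_nonneg : (0 : ℝ) ≤ l)]) (by positivity)
  obtain ⟨a1, a2, a3⟩ := strict_of_mem_interior_triangle hl hlk (hmem _ _ hδn hδn) rfl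
  obtain ⟨b1, b2, b3⟩ := strict_of_mem_interior_triangle hl hlk (hmem _ _ hδa hδa) rfl
  set θ := ((k : ℝ) + l) / (k + 2 * l)
  simp only at a1 a2 a3 b1 b2 b3
  have hyδ : 0 < y - δ := by
    have : 0 < (y - δ) * (2 * θ - 1) := by nlinarith
    exact pos_of_mul_pos_left this (by linarith)
  have hxδ : 0 < x - δ := by linarith
  have hxδ1 : x + δ < 1 := by
    have : 0 < (1 - (x + δ)) * (2 * θ - 1) :=
      b3.trans_le' (mul_nonneg (by linarith) (by linarith))
    linarith [pos_of_mul_pos_left this (by linarith)]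
  have hx0 : 0 < x := by linarith
  have hy0 : 0 < y := by linarith
  rw [ennreal_eq_ofReal_one_div hx0, ennreal_eq_ofReal_one_div hy0, ← hx, ← hy]
  obtain ⟨C, hC⟩ := exists_lintegral_conv_rpow_le
    (μ := surfaceMeasure (Metric.ball 0 1) (quadForm c)) (p := 1 / x) (q := 1 / y) (δ := δ)
    (by positivity) (by positivity) hδ0 (by simp; linarith) (by simp; linarith)
    (by simp; linarith) fun ε₁ h₁ ε₂ h₂ => by
      simp only [one_div_one_div]
      refine restrictedType_of_mem_interior hl hlk hc (p := (x + ε₁, y + ε₂)) (hmem _ _ ?_ ?_)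
      · rcases h₁ with rfl | rfl <;> assumption
      · rcases h₂ with rfl | rfl <;> assumption
  exact convolutionEstimate_of_lintegral _ (by positivity) (by positivity) fun f hf hfp =>
    exists_conv_norm_le (by positivity) (by positivity) hC hf hfp

theorem isHomogeneous_quadForm (c : Matrix (Fin k) (Fin l) ℝ) (j : Fin l) :
    (quadForm c j).IsHomogeneous 2 :=
  MvPolynomial.IsHomogeneous.sum _ _ _ fun i _ => by
    simpa using (MvPolynomial.isHomogeneous_C (Fin k) (c i j)).mul
      (MvPolynomial.isHomogeneous_X_pow (R := ℝ) i 2)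

theorem isModelSurface_quadForm (hl : 1 ≤ l) (hlk : l ≤ k) {c : Matrix (Fin k) (Fin l) ℝ}
    (hc : ConditionStar c) :
    IsModelSurface (surface (Metric.ball (0 : EuclideanSpace ℝ (Fin k)) 1) (quadForm c)) :=
  ⟨_, quadForm c, Metric.isOpen_ball, ⟨0, by simp⟩, fun j => ⟨2, isHomogeneous_quadForm c j⟩, rfl,
    fun _ _ h => convolutionEstimate_of_mem_interior hl hlk hc
      (interior_mono (fun _ hx => hx.1) h)⟩

/-- Rows of a Vandermonde matrix with distinct nodes satisfy the nondegeneracy condition. -/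
theorem exists_conditionStar (k l : ℕ) : ∃ c : Matrix (Fin k) (Fin l) ℝ, ConditionStar c := by
  refine ⟨Matrix.of fun i j => ((i : ℕ) : ℝ) ^ (j : ℕ), fun r => ?_⟩
  have : (Matrix.of fun (i : Fin k) (j : Fin l) => ((i : ℕ) : ℝ) ^ (j : ℕ)).submatrix r id =
      Matrix.vandermonde fun i => (((r i : Fin k) : ℕ) : ℝ) := rfl
  rw [this, Matrix.det_vandermonde_ne_zero_iff]
  intro i j hij
  exact r.injective (Fin.val_injective (Nat.cast_injective hij))

end Sufficiency

/-! ### Necessity of the triangle -/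

section Necessity

variable {k l : ℕ}

/-- Comparison of exponents at small scales. -/
theorem exponent_le_of_forall_mul_rpow_le {A B a b : ℝ} (hA : 0 < A)
    (h : ∀ δ : ℝ, 0 < δ → δ ≤ 1 → A * δ ^ a ≤ B * δ ^ b) : b ≤ a := by
  by_contra! hab
  have ht : Filter.Tendsto (fun δ : ℝ => B * δ ^ (b - a)) (nhdsWithin 0 (Set.Ioi 0))
      (nhds (B * 0)) := by
    refine Filter.Tendsto.const_mul B ?_
    have := (Real.continuousAt_rpow_const 0 (b - a) (Or.inr (by linarith))).tendsto
    rw [Real.zero_rpow (by linarith)] at this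
    exact this.mono_left nhdsWithin_le_nhds
  rw [mul_zero] at ht
  refine absurd (ge_of_tendsto ht ?_) (not_le.2 hA)
  filter_upwards [Ioc_mem_nhdsGT (zero_lt_one' ℝ)] with δ hδ
  have h1 := h δ hδ.1 hδ.2
  have hpos : 0 < δ ^ a := Real.rpow_pos_of_pos hδ.1 a
  rw [Real.rpow_sub hδ.1, ← mul_div_assoc, le_div_iff₀ hpos]
  exact h1

/-- The estimate tested on indicator functions. -/
theorem ConvolutionEstimate.exists_indicator_le {μ : Measure (Space k l)} [IsFiniteMeasure μ]
    {p q : ℝ≥0∞} (hp : 1 ≤ p) (hq : 1 ≤ q) (h : ConvolutionEstimate μ p q) :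
    ∃ C : ℝ, ∀ (E F : Set (Space k l)) (r : ℝ), 0 ≤ r → MeasurableSet E → MeasurableSet F →
      0 < volume.real E → 0 < volume.real F → (∀ z ∈ F, r ≤ μ.real {u | z - u ∈ E}) →
      r * volume.real F ^ (expPoint p q).2 ≤ C * volume.real E ^ (expPoint p q).1 := by
  obtain ⟨C, hC⟩ := h
  refine ⟨C, fun E F r hr hE hF hE0 hF0 hzr => ?_⟩
  have hp0 : p ≠ 0 := (zero_lt_one.trans_le hp).ne'
  have hq0 : q ≠ 0 := (zero_lt_one.trans_le hq).ne'
  have hE0' : volume E ≠ 0 := fun h0 => by simp [measureReal_def, h0] at hE0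
  have hEt : volume E ≠ ∞ := fun h0 => by simp [measureReal_def, h0] at hE0
  have hF0' : volume F ≠ 0 := fun h0 => by simp [measureReal_def, h0] at hF0
  have hFt : volume F ≠ ∞ := fun h0 => by simp [measureReal_def, h0] at hF0
  set f : Space k l → ℂ := E.indicator fun _ => 1 with hf
  obtain ⟨-, -, h3⟩ := hC f (memLp_indicator_const p hE 1 (Or.inr hEt))
  have hconv : ∀ z, measureConv μ f z = (μ.real {u | z - u ∈ E} : ℂ) := fun z => by
    have hm : MeasurableSet {u | z - u ∈ E} := (measurable_id.const_sub z) hE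
    have : (fun u => f (z - u)) = {u | z - u ∈ E}.indicator fun _ => (1 : ℂ) := by
      ext u; by_cases hu : z - u ∈ E <;> simp [hf, hu]
    rw [measureConv, this, integral_indicator hm]
    simp
  have hle : eLpNorm (F.indicator fun _ => (r : ℂ)) q volume ≤
      eLpNorm (measureConv μ f) q volume := by
    refine eLpNorm_mono fun z => ?_
    by_cases hz : z ∈ F
    · rw [Set.indicator_of_mem hz, hconv, Complex.norm_real, Complex.norm_real,
        Real.norm_of_nonneg hr, Real.norm_of_nonneg measureReal_nonneg]
      exact hzr z hz
    · rw [Set.indicator_of_notMem hz, norm_zero]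
      exact norm_nonneg _
  have key := hle.trans h3
  rw [hf, eLpNorm_indicator_const' hE hE0' hp0, eLpNorm_indicator_const' hF hF0' hq0] at key
  have e1 : ∀ p : ℝ≥0∞, 1 / p.toReal = (p⁻¹).toReal := fun p => by
    rw [ENNReal.toReal_inv, one_div]
  rw [e1, e1] at key
  have hfin : (C : ℝ≥0∞) * (‖(1 : ℂ)‖ₑ * volume E ^ (p⁻¹).toReal) ≠ ∞ :=
    ENNReal.mul_ne_top ENNReal.coe_ne_top (ENNReal.mul_ne_top (by simp)
      (ENNReal.rpow_ne_top_of_nonneg ENNReal.toReal_nonneg hEt))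
  have := ENNReal.toReal_mono hfin key
  simp only [ENNReal.toReal_mul, ← ENNReal.toReal_rpow, toReal_enorm, Complex.norm_real,
    Real.norm_of_nonneg hr, norm_one, one_mul, ENNReal.coe_toReal] at this
  exact this

theorem volumeReal_ball_eq {W : Type*} [NormedAddCommGroup W] [NormedSpace ℝ W]
    [FiniteDimensional ℝ W] [MeasurableSpace W] [BorelSpace W] (μ : Measure W)
    [μ.IsAddHaarMeasure] (x : W) {r : ℝ} (hr : 0 < r) :
    μ.real (Metric.ball x r) = r ^ Module.finrank ℝ W * μ.real (Metric.ball 0 1) := by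
  rw [measureReal_def, Measure.addHaar_ball_of_pos μ x hr, ENNReal.toReal_mul,
    ENNReal.toReal_ofReal (by positivity), measureReal_def]

theorem volumeReal_ball_pos {W : Type*} [NormedAddCommGroup W] [NormedSpace ℝ W]
    [FiniteDimensional ℝ W] [MeasurableSpace W] [BorelSpace W] (μ : Measure W)
    [μ.IsAddHaarMeasure] (x : W) {r : ℝ} (hr : 0 < r) : 0 < μ.real (Metric.ball x r) :=
  ENNReal.toReal_pos (Metric.measure_ball_pos μ x hr).ne' Metric.isBounded_ball.measure_lt_top.ne

theorem volumeReal_ball_space (k l : ℕ) (x : Space k l) {r : ℝ} (hr : 0 < r) :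
    volume.real (Metric.ball x r) =
      r ^ ((k : ℝ) + l) * volume.real (Metric.ball (0 : Space k l) 1) := by
  rw [volumeReal_ball_eq _ x hr, Module.finrank_prod, finrank_euclideanSpace_fin,
    finrank_euclideanSpace_fin, ← Nat.cast_add, Real.rpow_natCast]

/-- The vertical `τ`-neighbourhood of the part of the graph of `Ψ` over the ball of radius `ρ`. -/
def tube (Ψ : EuclideanSpace ℝ (Fin k) → EuclideanSpace ℝ (Fin l)) (ρ τ : ℝ) : Set (Space k l) :=
  {p | ‖p.1‖ < ρ ∧ ‖p.2 - Ψ p.1‖ < τ}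

theorem measurableSet_tube {Ψ : EuclideanSpace ℝ (Fin k) → EuclideanSpace ℝ (Fin l)}
    (hΨ : Continuous Ψ) (ρ τ : ℝ) : MeasurableSet (tube Ψ ρ τ) := by
  have h1 : IsOpen {p : Space k l | ‖p.1‖ < ρ} := isOpen_lt (by fun_prop) continuous_const
  have h2 : IsOpen {p : Space k l | ‖p.2 - Ψ p.1‖ < τ} :=
    isOpen_lt (by fun_prop) continuous_const
  exact (h1.inter h2).measurableSet

theorem volumeReal_tube {Ψ : EuclideanSpace ℝ (Fin k) → EuclideanSpace ℝ (Fin l)}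
    (hΨ : Continuous Ψ) (ρ : ℝ) {τ : ℝ} (hτ : 0 < τ) :
    volume.real (tube Ψ ρ τ) = τ ^ l * (volume.real (Metric.ball (0 : EuclideanSpace ℝ (Fin k)) ρ) *
      volume.real (Metric.ball (0 : EuclideanSpace ℝ (Fin l)) 1)) := by
  have h1 : volume (tube Ψ ρ τ) = volume (Metric.ball (0 : EuclideanSpace ℝ (Fin k)) ρ) *
      volume (Metric.ball (0 : EuclideanSpace ℝ (Fin l)) τ) := by
    rw [Measure.volume_eq_prod, Measure.prod_apply (measurableSet_tube hΨ ρ τ),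
      mul_comm, ← setLIntegral_const, ← lintegral_indicator Metric.isOpen_ball.measurableSet]
    refine lintegral_congr fun y => ?_
    by_cases hy : y ∈ Metric.ball (0 : EuclideanSpace ℝ (Fin k)) ρ
    · rw [Set.indicator_of_mem hy, ← Measure.addHaar_ball_center volume (Ψ y)]
      congr 1
      ext z
      simp only [tube, Set.mem_preimage, Set.mem_ofPred_eq, mem_ball_iff_norm]
      exact and_iff_right (by simpa using hy)
    · rw [Set.indicator_of_notMem hy]
      convert measure_empty (μ := (volume : Measure (EuclideanSpace ℝ (Fin l))))
      ext z
      simp only [tube, Set.mem_preimage, Set.mem_ofPred_eq, Set.mem_empty_iff_false, iff_false]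
      exact fun h => hy (by simpa using h.1)
  rw [measureReal_def, h1, ENNReal.toReal_mul]
  change volume.real _ * volume.real _ = _
  rw [volumeReal_ball_eq volume (0 : EuclideanSpace ℝ (Fin l)) hτ, finrank_euclideanSpace_fin]
  ring

/-- The vertical component of the parametrisation of the surface. -/
noncomputable def quadMap (c : Matrix (Fin k) (Fin l) ℝ) (y : EuclideanSpace ℝ (Fin k)) :
    EuclideanSpace ℝ (Fin l) := (graphMap (quadForm c) y).2

theorem quadMap_apply (c : Matrix (Fin k) (Fin l) ℝ) (y : EuclideanSpace ℝ (Fin k)) (j : Fin l) :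
    quadMap c y j = ∑ i, c i j * y i ^ 2 := by
  simp [quadMap, graphMap, quadForm]

theorem contDiff_quadMap (c : Matrix (Fin k) (Fin l) ℝ) : ContDiff ℝ 1 (quadMap c) := by
  refine contDiff_euclidean.2 fun j => ?_
  simp_rw [quadMap_apply]
  fun_prop

theorem quadMap_neg (c : Matrix (Fin k) (Fin l) ℝ) (y : EuclideanSpace ℝ (Fin k)) :
    quadMap c (-y) = quadMap c y := by
  ext j; simp [quadMap_apply]

theorem exists_quadMap_lipschitz (c : Matrix (Fin k) (Fin l) ℝ) :
    ∃ L : ℝ, 0 ≤ L ∧ ∀ y y' : EuclideanSpace ℝ (Fin k), ‖y‖ ≤ 2 → ‖y'‖ ≤ 2 →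
      ‖quadMap c y - quadMap c y'‖ ≤ L * ‖y - y'‖ := by
  obtain ⟨L, hL⟩ := ((contDiff_quadMap c).locallyLipschitz.locallyLipschitzOn
    (s := Metric.closedBall 0 2)).exists_lipschitzOnWith_of_compact (isCompact_closedBall _ _)
  refine ⟨L, L.2, fun y y' hy hy' => ?_⟩
  simpa [dist_eq_norm] using hL.dist_le_mul y (by simpa using hy) y' (by simpa using hy')

theorem surfaceMeasure_real_apply (c : Matrix (Fin k) (Fin l) ℝ) {A : Set (Space k l)}
    (hA : MeasurableSet A) : (surfaceMeasure (Metric.ball 0 1) (quadForm c)).real A =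
      volume.real {y : EuclideanSpace ℝ (Fin k) | (y, quadMap c y) ∈ A ∧ ‖y‖ < 1} := by
  have hm := (continuous_graphMap (quadForm c)).measurable
  rw [measureReal_def, surfaceMeasure, Measure.map_apply hm hA, Measure.restrict_apply (hm hA),
    measureReal_def]
  congr 2
  ext y
  simp only [Set.mem_inter_iff, Set.mem_preimage, mem_ball_zero_iff]
  rfl

/-- A set that contains `z - S` is charged with the full mass of the surface at `z`. -/
theorem surfaceMeasure_real_eq (c : Matrix (Fin k) (Fin l) ℝ) {E : Set (Space k l)}
    (hE : MeasurableSet E) {z : Space k l}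
    (h : ∀ y : EuclideanSpace ℝ (Fin k), ‖y‖ < 1 → (z.1 - y, z.2 - quadMap c y) ∈ E) :
    (surfaceMeasure (Metric.ball 0 1) (quadForm c)).real {u | z - u ∈ E} =
      volume.real (Metric.ball (0 : EuclideanSpace ℝ (Fin k)) 1) := by
  have hm : MeasurableSet {u | z - u ∈ E} := (measurable_id.const_sub z) hE
  rw [surfaceMeasure_real_apply c hm]
  congr 1
  ext y
  simp only [Set.mem_ofPred_eq, mem_ball_zero_iff]
  exact and_iff_right_of_imp (h y)

theorem norm_quadMap_le {c : Matrix (Fin k) (Fin l) ℝ} {L : ℝ} (hL0 : 0 ≤ L)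
    (hL : ∀ y y' : EuclideanSpace ℝ (Fin k), ‖y‖ ≤ 2 → ‖y'‖ ≤ 2 →
      ‖quadMap c y - quadMap c y'‖ ≤ L * ‖y - y'‖) {y : EuclideanSpace ℝ (Fin k)} (hy : ‖y‖ < 1) :
    ‖quadMap c y‖ ≤ L := by
  have h0 : quadMap c 0 = 0 := by ext j; simp [quadMap_apply]
  have := hL y 0 (by linarith) (by simp)
  rw [h0, sub_zero, sub_zero] at this
  nlinarith

/-- For a ball of radius of order `1 / δ`, the convolution is the full mass of the surface on a ball
of comparable radius; let `δ → 0`. -/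
theorem snd_le_fst_of_convolutionEstimate (hl : 1 ≤ l) (c : Matrix (Fin k) (Fin l) ℝ) {p q : ℝ≥0∞}
    (hp : 1 ≤ p) (hq : 1 ≤ q)
    (h : ConvolutionEstimate (surfaceMeasure (Metric.ball 0 1) (quadForm c)) p q) :
    (expPoint p q).2 ≤ (expPoint p q).1 := by
  obtain ⟨C, hC⟩ := h.exists_indicator_le hp hq
  obtain ⟨L, hL0, hL⟩ := exists_quadMap_lipschitz c
  set x := (expPoint p q).1
  set y := (expPoint p q).2
  set m := volume.real (Metric.ball (0 : EuclideanSpace ℝ (Fin k)) 1)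
  set v := volume.real (Metric.ball (0 : Space k l) 1)
  have hm : 0 < m := volumeReal_ball_pos _ _ one_pos
  have hv : 0 < v := volumeReal_ball_pos _ _ one_pos
  set d : ℝ := (k : ℝ) + l
  have hd : 0 < d := by
    have : (0 : ℝ) < l := by exact_mod_cast hl
    positivity
  have key : -d * x ≤ -d * y := by
    refine exponent_le_of_forall_mul_rpow_le (A := m * v ^ y)
      (B := C * (((L + 2) ^ d) * v) ^ x) (by positivity) fun δ hδ hδ1 => ?_
    have h1 := hC (Metric.ball 0 ((L + 2) / δ)) (Metric.ball 0 (1 / δ)) m hm.le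
      Metric.isOpen_ball.measurableSet Metric.isOpen_ball.measurableSet
      (volumeReal_ball_pos _ _ (by positivity)) (volumeReal_ball_pos _ _ (by positivity))
      fun z hz => (surfaceMeasure_real_eq c Metric.isOpen_ball.measurableSet fun w hw => ?_).ge
    · have hvs : ∀ r : ℝ, 0 < r → volume.real (Metric.ball (0 : Space k l) r) = r ^ d * v :=
        fun r hr => volumeReal_ball_space k l 0 hr
      rw [hvs _ (by positivity), hvs _ (by positivity),
        Real.div_rpow (show (0 : ℝ) ≤ L + 2 by positivity) hδ.le,
        Real.div_rpow zero_le_one hδ.le, Real.one_rpow] at h1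
      have e1 : (1 / δ ^ d * v) ^ y = v ^ y * δ ^ (-d * y) := by
        rw [one_div, ← Real.rpow_neg hδ.le, Real.mul_rpow (by positivity) hv.le,
          ← Real.rpow_mul hδ.le, mul_comm]
      have e2 : ((L + 2) ^ d / δ ^ d * v) ^ x = ((L + 2) ^ d * v) ^ x * δ ^ (-d * x) := by
        rw [div_eq_mul_inv, ← Real.rpow_neg hδ.le, mul_right_comm,
          Real.mul_rpow (by positivity) (by positivity), ← Real.rpow_mul hδ.le]
      rw [e1, e2, ← mul_assoc, ← mul_assoc] at h1
      exact h1
    · have hz' : ‖z.1‖ < 1 / δ ∧ ‖z.2‖ < 1 / δ := by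
        have : ‖z‖ < 1 / δ := by simpa using hz
        exact ⟨(norm_fst_le z).trans_lt this, (norm_snd_le z).trans_lt this⟩
      have h1δ : 1 ≤ 1 / δ := by rw [le_div_iff₀ hδ]; linarith
      have e : (L + 2) / δ = L * (1 / δ) + 2 * (1 / δ) := by ring
      have hLδ : L ≤ L * (1 / δ) := le_mul_of_one_le_right hL0 h1δ
      have hΦ := norm_quadMap_le hL0 hL hw
      rw [mem_ball_zero_iff, Prod.norm_def, max_lt_iff]
      exact ⟨(norm_sub_le _ _).trans_lt (by linarith), (norm_sub_le _ _).trans_lt (by linarith)⟩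
  nlinarith

/-- For a neighbourhood of `-S` of width of order `δ`, and so of measure `O(δ ^ l)`, the convolution
is the full mass of the surface on the ball of radius `δ`. -/
theorem mul_fst_le_of_convolutionEstimate (c : Matrix (Fin k) (Fin l) ℝ) {p q : ℝ≥0∞}
    (hp : 1 ≤ p) (hq : 1 ≤ q)
    (h : ConvolutionEstimate (surfaceMeasure (Metric.ball 0 1) (quadForm c)) p q) :
    l * (expPoint p q).1 ≤ (k + l) * (expPoint p q).2 := by
  obtain ⟨C, hC⟩ := h.exists_indicator_le hp hq
  obtain ⟨L, hL0, hL⟩ := exists_quadMap_lipschitz c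
  set x := (expPoint p q).1
  set y := (expPoint p q).2
  set m := volume.real (Metric.ball (0 : EuclideanSpace ℝ (Fin k)) 1)
  set v := volume.real (Metric.ball (0 : Space k l) 1)
  set w := volume.real (Metric.ball (0 : EuclideanSpace ℝ (Fin k)) 2) *
      volume.real (Metric.ball (0 : EuclideanSpace ℝ (Fin l)) 1)
  have hm : 0 < m := volumeReal_ball_pos _ _ one_pos
  have hv : 0 < v := volumeReal_ball_pos _ _ one_pos
  have hw : 0 < w :=
    mul_pos (volumeReal_ball_pos _ _ (by norm_num)) (volumeReal_ball_pos _ _ one_pos)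
  have hcont : Continuous fun y => -quadMap c y := (contDiff_quadMap c).continuous.neg
  refine exponent_le_of_forall_mul_rpow_le (A := m * v ^ y)
    (B := C * ((L + 1) ^ l * w) ^ x) (by positivity) fun δ hδ hδ1 => ?_
  have hτ : 0 < (L + 1) * δ := by positivity
  have hvol := volumeReal_tube hcont 2 hτ
  have h1 := hC (tube (fun y => -quadMap c y) 2 ((L + 1) * δ)) (Metric.ball 0 δ) m hm.le
    (measurableSet_tube hcont _ _) Metric.isOpen_ball.measurableSet
    (by rw [hvol]; positivity) (volumeReal_ball_pos _ _ hδ)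
    fun z hz => (surfaceMeasure_real_eq c (measurableSet_tube hcont _ _) fun y' hy' => ?_).ge
  · rw [hvol, volumeReal_ball_space k l _ hδ] at h1
    have e1 : (δ ^ ((k : ℝ) + l) * v) ^ y = v ^ y * δ ^ ((k + l) * y) := by
      rw [Real.mul_rpow (by positivity) hv.le, ← Real.rpow_mul hδ.le, mul_comm]
    have e2 : (((L + 1) * δ) ^ l * w) ^ x = ((L + 1) ^ l * w) ^ x * δ ^ (l * x) := by
      rw [mul_pow, mul_right_comm, Real.mul_rpow (by positivity) (by positivity),
        ← Real.rpow_natCast δ l, ← Real.rpow_mul hδ.le]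
    rw [e1, e2, ← mul_assoc, ← mul_assoc] at h1
    exact h1
  · have hz' : ‖z.1‖ < δ ∧ ‖z.2‖ < δ := by
      have : ‖z‖ < δ := by simpa using hz
      exact ⟨(norm_fst_le z).trans_lt this, (norm_snd_le z).trans_lt this⟩
    have hn : ‖z.1 - y'‖ < 2 := (norm_sub_le _ _).trans_lt (by linarith)
    refine ⟨hn, ?_⟩
    -- `Φ` is even, so `-Φ (z.1 - y')` is within `L δ` of `-Φ y'`
    have h2 := hL (z.1 - y') (-y') hn.le (by rw [norm_neg]; linarith)
    rw [quadMap_neg, sub_neg_eq_add, sub_add_cancel] at h2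
    have e : z.2 - quadMap c y' - -quadMap c (z.1 - y') =
        z.2 + (quadMap c (z.1 - y') - quadMap c y') := by abel
    simp only [e]
    have h3 : L * ‖z.1‖ ≤ L * δ := mul_le_mul_of_nonneg_left hz'.1.le hL0
    exact (norm_add_le _ _).trans_lt (by linarith)

/-- For the ball of radius `δ`, the convolution is at least a constant times `δ ^ k` on a
neighbourhood of half of `S` of measure comparable to `δ ^ l`. -/
theorem mul_fst_le_add_of_convolutionEstimate (c : Matrix (Fin k) (Fin l) ℝ) {p q : ℝ≥0∞}
    (hp : 1 ≤ p) (hq : 1 ≤ q)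
    (h : ConvolutionEstimate (surfaceMeasure (Metric.ball 0 1) (quadForm c)) p q) :
    (k + l) * (expPoint p q).1 ≤ k + l * (expPoint p q).2 := by
  obtain ⟨C, hC⟩ := h.exists_indicator_le hp hq
  obtain ⟨L, hL0, hL⟩ := exists_quadMap_lipschitz c
  set x := (expPoint p q).1
  set y := (expPoint p q).2
  set m := volume.real (Metric.ball (0 : EuclideanSpace ℝ (Fin k)) 1)
  set v := volume.real (Metric.ball (0 : Space k l) 1)
  set w := volume.real (Metric.ball (0 : EuclideanSpace ℝ (Fin k)) (1 / 2)) *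
      volume.real (Metric.ball (0 : EuclideanSpace ℝ (Fin l)) 1)
  have hm : 0 < m := volumeReal_ball_pos _ _ one_pos
  have hv : 0 < v := volumeReal_ball_pos _ _ one_pos
  have hw : 0 < w :=
    mul_pos (volumeReal_ball_pos _ _ (by norm_num)) (volumeReal_ball_pos _ _ one_pos)
  have hcont : Continuous (quadMap c) := (contDiff_quadMap c).continuous
  set a : ℝ := 1 / (2 * (L + 1)) with ha
  have ha0 : 0 < a := by positivity
  have haL : (L + 1) * a = 1 / 2 := by rw [ha]; field_simp
  have ha2 : a ≤ 1 / 2 := by nlinarith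
  refine exponent_le_of_forall_mul_rpow_le (A := a ^ k * m * (a ^ l * w) ^ y)
    (B := C * v ^ x) (by positivity) fun δ hδ hδ1 => ?_
  have haδ : 0 < a * δ := by positivity
  have hvol := volumeReal_tube hcont (1 / 2) haδ
  have h1 := hC (Metric.ball 0 δ) (tube (quadMap c) (1 / 2) (a * δ)) ((a * δ) ^ k * m)
    (by positivity) Metric.isOpen_ball.measurableSet (measurableSet_tube hcont _ _)
    (volumeReal_ball_pos _ _ hδ) (by rw [hvol]; positivity) fun z hz => ?_
  · rw [hvol, volumeReal_ball_space k l _ hδ] at h1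
    have e1 : (δ ^ ((k : ℝ) + l) * v) ^ x = v ^ x * δ ^ ((k + l) * x) := by
      rw [Real.mul_rpow (by positivity) hv.le, ← Real.rpow_mul hδ.le, mul_comm]
    have e2 : ((a * δ) ^ l * w) ^ y = (a ^ l * w) ^ y * δ ^ (l * y) := by
      rw [mul_pow, mul_right_comm, Real.mul_rpow (by positivity) (by positivity),
        ← Real.rpow_natCast δ l, ← Real.rpow_mul hδ.le]
    have e3 : (a * δ) ^ k * m = a ^ k * m * δ ^ (k : ℝ) := by
      rw [mul_pow, Real.rpow_natCast]; ring
    rw [e1, e2, e3, ← mul_assoc C] at h1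
    rw [Real.rpow_add hδ]
    linarith
  · have hms : MeasurableSet {u | z - u ∈ Metric.ball (0 : Space k l) δ} :=
      (measurable_id.const_sub z) Metric.isOpen_ball.measurableSet
    rw [surfaceMeasure_real_apply c hms]
    have hb := volumeReal_ball_eq volume z.1 haδ
    rw [finrank_euclideanSpace_fin] at hb
    rw [← hb]
    refine measureReal_mono ?_ ?_
    · intro y' hy'
      have hy1 : ‖y' - z.1‖ < a * δ := by simpa [dist_eq_norm] using hy'
      have haδ2 : a * δ ≤ 1 / 2 := (mul_le_of_le_one_right ha0.le hδ1).trans ha2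
      have hn : ‖y'‖ < 1 := by
        have h4 := norm_add_le (y' - z.1) z.1
        rw [sub_add_cancel] at h4
        linarith [hz.1]
      refine ⟨?_, hn⟩
      simp only [Set.mem_ofPred_eq, mem_ball_zero_iff, Prod.norm_def, max_lt_iff, Prod.fst_sub,
        Prod.snd_sub]
      constructor
      · rw [norm_sub_rev]; nlinarith
      · have h2 := hL z.1 y' (by linarith [hz.1]) (by linarith)
        have e : z.2 - quadMap c y' = (z.2 - quadMap c z.1) + (quadMap c z.1 - quadMap c y') := by
          abel
        rw [e]
        rw [norm_sub_rev] at hy1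
        have h3 : L * ‖z.1 - y'‖ ≤ L * (a * δ) := mul_le_mul_of_nonneg_left hy1.le hL0
        have h4 : a * δ + L * (a * δ) = δ / 2 := by linear_combination δ * haL
        exact (norm_add_le _ _).trans_lt (by linarith [hz.2])
    · exact ((measure_mono fun y' hy' => by simpa using hy'.2).trans_lt
        (Metric.isBounded_ball (x := (0 : EuclideanSpace ℝ (Fin k))) (r := 1)).measure_lt_top).ne

theorem expPoint_mem_triangle (hl : 1 ≤ l) (hlk : l ≤ k) (c : Matrix (Fin k) (Fin l) ℝ)
    {p q : ℝ≥0∞} (hp : 1 ≤ p) (hq : 1 ≤ q)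
    (h : ConvolutionEstimate (surfaceMeasure (Metric.ball 0 1) (quadForm c)) p q) :
    expPoint p q ∈ triangle k (k + l) := by
  have h1 := snd_le_fst_of_convolutionEstimate hl c hp hq h
  have h2 := mul_fst_le_of_convolutionEstimate c hp hq h
  have h3 := mul_fst_le_add_of_convolutionEstimate c hp hq h
  have hl' : (0 : ℝ) < l := by exact_mod_cast hl
  have hk' : (0 : ℝ) < k := by exact_mod_cast hl.trans hlk
  have hD : (0 : ℝ) < k + 2 * l := by positivity
  rw [triangle_eq hl, mem_convexHull_triple_iff (half_lt_vertex hl hlk)]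
  refine ⟨h1, ?_, ?_⟩
  · rw [div_mul_eq_mul_div, le_div_iff₀ hD]
    linarith
  · have e1 : 1 - ((k : ℝ) + l) / (k + 2 * l) = l / (k + 2 * l) := by field_simp; ring
    have e2 : 2 * (((k : ℝ) + l) / (k + 2 * l)) - 1 = k / (k + 2 * l) := by field_simp; ring
    rw [e1, e2, ← mul_div_assoc, ← mul_div_assoc]
    refine div_le_div_of_nonneg_right ?_ hD.le
    linarith

end Necessity
end ModelSurface

theorem mainTheorem1 (k l : ℕ) (hl : 1 ≤ l) (hlk : l ≤ k) :
    (∀ c : Matrix (Fin k) (Fin l) ℝ, ModelSurface.ConditionStar c →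
      ModelSurface.IsModelSurface
        (ModelSurface.surface (Metric.ball (0 : EuclideanSpace ℝ (Fin k)) 1)
          (ModelSurface.quadForm c)) ∧
      (∀ p q : ℝ≥0∞,
        ModelSurface.expPoint p q ∈ interior (ModelSurface.triangle k (k + l)) →
        ModelSurface.ConvolutionEstimate
          (ModelSurface.surfaceMeasure (Metric.ball (0 : EuclideanSpace ℝ (Fin k)) 1)
            (ModelSurface.quadForm c)) p q) ∧
      (∀ p q : ℝ≥0∞, 1 ≤ p → 1 ≤ q →
        ModelSurface.ConvolutionEstimate
          (ModelSurface.surfaceMeasure (Metric.ball (0 : EuclideanSpace ℝ (Fin k)) 1)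
            (ModelSurface.quadForm c)) p q →
        ModelSurface.expPoint p q ∈ ModelSurface.triangle k (k + l))) ∧
    (∃ c : Matrix (Fin k) (Fin l) ℝ, ModelSurface.ConditionStar c) :=
  ⟨fun c hc => ⟨ModelSurface.isModelSurface_quadForm hl hlk hc,
    fun _ _ h => ModelSurface.convolutionEstimate_of_mem_interior hl hlk hc h,
    fun _ _ hp hq h => ModelSurface.expPoint_mem_triangle hl hlk c hp hq h⟩,
    ModelSurface.exists_conditionStar k l⟩
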